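/- **Notation.** Let $\alpha=\frac{\theta+\sqrt{\theta^2-4}}2$ with an integer $\theta\ge 3$, and let $r\ge1$ be an integer. For $a,b\in\mathbb R^2$ put $b\wedge a=b_1a_2-b_2a_1$ and, if $a,b$ are linearly independent, let $N(\alpha,a,b)$ be the real matrix $N$ with $Na=\alpha a$, $Nb=\alpha^{-1}b$. Such a pair $(a,b)$ is *compatible* if $N(\alpha,a,b)\in M_2(\mathbb Z)$. Then $c\in\mathbb R^2$ is *compatible* with $(a,b)$ if there is a (necessarily unique) $p=\pi_{a,b,r}(c)\in\mathbb Z^2$ with $$(I-N)\Big(c-\tfrac12\begin{pmatrix}a_1b_1\\a_2b_2\end{pmatrix}\Big)-\tfrac{b\wedge a}{2}\begin{pmatrix}n_{11}n_{12}\\n_{21}n_{22}\end{pmatrix}=\tfrac{b\wedge a}{r}\,p,\qquad N=(n_{ij})=N(\alpha,a,b).$$ Let $[c]$, $[t]$ be the classes of $c$ modulo $\frac{b\wedge a}r\mathbb Z^2$ and of $t\in\mathbb C$ modulo $\frac{b\wedge a}r\mathbb Z$, and let $\mathscr A$ be the space of all $(a,b,[c],[t])$ with $(a,b)$ compatible,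 $c$ compatible with $(a,b)$ and $t\in\mathbb C$. The group $\mathcal G$ of all $((\mu,\rho),(K,k))\in(\mathbb R_{>0}\times\mathbb R^*)\times(\mathrm{GL}(2,\mathbb Z)\ltimes\mathbb Z^2)$ acts on $\mathscr A$ by $(a,b,[c],[t])\mapsto K\cdot(k\cdot(\mu a,\rho b,[\mu\rho c],[\mu\rho t]))$, where, with $kv=k_1v_1+k_2v_2$ for $v\in\mathbb R^2$, * $k\cdot(a,b,[c],[t])=(a,b,[c'],[t'])$ with $c'=c-\frac{\alpha(ka)}{\alpha-1}b-\frac{kb}{\alpha-1}a$ and $t'=t+\frac{\alpha(ka)(kb)}{1-\alpha}+kc+\frac{k_1(k_1-1)a_1b_1+k_2(k_2-1)a_2b_2}2+k_1k_2b_1a_2$; * $K\cdot(a,b,[c],[t])=(A,B,[C],[t])$ with $A=Ka$, $B=Kb$ and $C=\frac12\begin{pmatrix}A_1B_1\\A_2B_2\end{pmatrix}+K\Big(c-\frac12\begin{pmatrix}a_1b_1\\a_2b_2\end{pmatrix}\Big)+\frac{b\wedge a}2\begin{pmatrix}k_{11}k_{12}\\k_{21}k_{22}\end{pmatrix}$,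 $K=(k_{ij})$. The *type II moduli set* is the quotient $\mathscr Q=\mathscr A/\mathcal G$, with the quotient topology. A function on an open subset of (a fibre below in) $\mathscr Q$ is holomorphic if it is holomorphic in $t$ for all fixed $(a,b,c)$; biholomorphic means homeomorphic in a way that identifies the holomorphic functions on open subsets. Let $\mathcal N_\alpha$ be the set of $N\in\mathrm{SL}(2,\mathbb Z)$ with eigenvalue $\alpha$, let $\sim$ be $\mathrm{GL}(2,\mathbb Z)$-similarity, and put $\Psi:\mathscr Q\to\mathcal N_\alpha/{\sim}$, $[(a,b,c,t)]\mapsto[N(\alpha,a,b)]$, and $\Phi([(a,b,c,t)])=[(a,b)]$, the class of $(a,b)$ under $(a,b)\mapsto(\mu Ka,\rho Kb)$. **Theorem.** Every element of $\mathcal N_\alpha$ is $N(\alpha,a,b)$ for some compatible pair $(a,b)$. Let $(a,b)$ be a compatible pair and $N=N(\alpha,a,b)$. Then $\Psi^{-1}([N])=\Phi^{-1}([(a,b)])$, and: 1. Each connected component of this fibre is biholomorphic to $\mathbb C^*$ or to $\mathbb C$, and is the component associated with some compatible $c$ as in 2. 2. Let $c$ be compatible with $(a,b)$, let $\mathcal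 G_{(a,b)}$ be the stabiliser of $(a,b)$ in $\mathcal G$, and put $p=\pi_{a,b,r}(c)$. The set of all $[(a,b,c',t)]$ with $t\in\mathbb C$ and $[c']\in\mathcal G_{(a,b)}[c]$ is a connected component of the fibre (the one associated with $\mathcal G_{(a,b)}[c]$). It is biholomorphic to $\mathbb C$ if and only if (C) there is $L\in\mathrm{GL}(2,\mathbb Z)$ with $LN=NL$, $La\in\mathbb R_{>0}a$, $\det L=-1$ and $(I+L)p\in r\mathbb Z^2+(I-N)\mathbb Z^2$. 3. With $c$, $p$ as in 2, let $H$ be the image of the stabiliser of $[c]$ in $\mathcal G_{(a,b)}$ in the group of bijections of $\mathbb C/\frac{b\wedge a}r\mathbb Z$. Then $H$ is a finite subgroup of the group generated by the translations by torsion elements and by $x\mapsto-x$, and $H$ contains an element of the form $x\mapsto -x+\tau$ (one that interchanges the two ends of the cylinder) if and only if (C) holds. -/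

import Mathlib

open scoped Manifold

noncomputable section

namespace InoueII

/-! ### Parameters of type II Inoue surfaces -/

/-- `α` is `S⁺`-admissible: `α = (θ + √(θ² - 4)) / 2` with `θ ∈ ℕ`, `θ ≥ 3`. -/
def SPlusAdmissible (α : ℝ) : Prop :=
  ∃ θ : ℕ, 3 ≤ θ ∧ α = ((θ : ℝ) + Real.sqrt ((θ : ℝ) ^ 2 - 4)) / 2

/-- `b ∧ a = b₁ a₂ - b₂ a₁`. -/
def wedge (b a : Fin 2 → ℝ) : ℝ := b 0 * a 1 - b 1 * a 0

/-- An integral matrix regarded as a real matrix. -/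
def toReal (M : Matrix (Fin 2) (Fin 2) ℤ) : Matrix (Fin 2) (Fin 2) ℝ :=
  M.map (fun n : ℤ => (n : ℝ))

/-- An integral vector regarded as a real vector. -/
def vecReal (v : Fin 2 → ℤ) : Fin 2 → ℝ := fun i => (v i : ℝ)

/-- The matrix with columns `a`, `b`. -/
def colMatrix (a b : Fin 2 → ℝ) : Matrix (Fin 2) (Fin 2) ℝ := !![a 0, b 0; a 1, b 1]

/-- The matrix `N(α,a,b)`, with eigenvectors `a` (eigenvalue `α`) and `b` (eigenvalue `α⁻¹`). -/
def matN (α : ℝ) (a b : Fin 2 → ℝ) : Matrix (Fin 2) (Fin 2) ℝ :=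
  colMatrix a b * Matrix.diagonal ![α, α⁻¹] * (colMatrix a b)⁻¹

/-- `(a,b)` is an `α`-compatible pair. -/
def CompatiblePair (α : ℝ) (a b : Fin 2 → ℝ) : Prop :=
  LinearIndependent ℝ ![a, b] ∧
    ∃ M : Matrix (Fin 2) (Fin 2) ℤ, matN α a b = toReal M

/-- The set of `α`-compatible pairs. -/
abbrev Pairs (α : ℝ) : Type :=
  {x : (Fin 2 → ℝ) × (Fin 2 → ℝ) // CompatiblePair α x.1 x.2}

/-- The coordinatewise product `(a₁ b₁, a₂ b₂)`. -/
def coordProd (a b : Fin 2 → ℝ) : Fin 2 → ℝ := fun i => a i * b i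

/-- The vector `(m₁₁ m₁₂, m₂₁ m₂₂)` of products of the entries in each row of `M`. -/
def rowProd (M : Matrix (Fin 2) (Fin 2) ℝ) : Fin 2 → ℝ := fun i => M i 0 * M i 1

/-- The relation `π_{a,b,r}(c) = p`, i.e.
`(I - N)(c - ½ (a₁b₁, a₂b₂)) - ((b ∧ a)/2) (n₁₁n₁₂, n₂₁n₂₂) = ((b ∧ a)/r) p`, with `N = N(α,a,b)`. -/
def HasPi (α : ℝ) (r : ℕ) (a b c : Fin 2 → ℝ) (p : Fin 2 → ℤ) : Prop :=
  (1 - matN α a b).mulVec (c - (1 / 2 : ℝ) • coordProd a b)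
      - (wedge b a / 2) • rowProd (matN α a b)
    = (wedge b a / (r : ℝ)) • vecReal p

/-- `c` is `(a,b,r)`-compatible. -/
def CompatibleVec (α : ℝ) (r : ℕ) (a b c : Fin 2 → ℝ) : Prop :=
  ∃ p : Fin 2 → ℤ, HasPi α r a b c p

/-- Quadruples `(a,b,c,t) ∈ ℝ² × ℝ² × ℝ² × ℂ`. -/
abbrev Quad : Type := (Fin 2 → ℝ) × (Fin 2 → ℝ) × (Fin 2 → ℝ) × ℂ

/-- The space of parameters `(a,b,c,t)`, where `(a,b)` is `α`-compatible, `c` is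
`(a,b,r)`-compatible and `t ∈ ℂ`. It has the subspace topology of `ℝ² × ℝ² × ℝ² × ℂ`. This is also
the product of the topology of `ℂ` with the coarsest topology on the set of triples `(a,b,c)` that
makes `(a,b)`, `N(α,a,b)` and `π_{a,b,r}(c)` continuous: the last two are continuous functions of
`(a,b,c)`, and `c` is a continuous function of `(a,b)`, `N(α,a,b)`, `π_{a,b,r}(c)`. -/
abbrev Params (α : ℝ) (r : ℕ) : Type :=
  {x : Quad // CompatiblePair α x.1 x.2.1 ∧ CompatibleVec α r x.1 x.2.1 x.2.2.1}

/-! ### The group acting on the parameters, and the moduli set -/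

/-- An element `((μ,ρ),(K,k))` of `(ℝ_{>0} × ℝ^*) × (GL(2,ℤ) ⋉ ℤ²)`. -/
structure GroupElt where
  μ : ℝ
  ρ : ℝ
  K : GL (Fin 2) ℤ
  k : Fin 2 → ℤ
  μ_pos : 0 < μ
  ρ_ne : ρ ≠ 0

/-- `(μ,ρ) · (a,b,c,t) = (μ a, ρ b, μρ c, μρ t)`. -/
def scaleAct (μ ρ : ℝ) : Quad → Quad
  | (a, b, c, t) => (μ • a, ρ • b, (μ * ρ) • c, ((μ * ρ : ℝ) : ℂ) * t)

/-- The product `k v = k₁ v₁ + k₂ v₂` of an integral row vector and a real column vector. -/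
def rowMul (k : Fin 2 → ℤ) (v : Fin 2 → ℝ) : ℝ := (k 0 : ℝ) * v 0 + (k 1 : ℝ) * v 1

/-- `k · (a,b,c,t) = (a, b, k · c, k ·_c t)` for `k ∈ ℤ²`. -/
def transAct (α : ℝ) (k : Fin 2 → ℤ) : Quad → Quad
  | (a, b, c, t) =>
    (a, b,
      c - (α * rowMul k a / (α - 1)) • b - (rowMul k b / (α - 1)) • a,
      t + ((α * rowMul k a * rowMul k b / (1 - α) + rowMul k c
        + ((k 0 : ℝ) * ((k 0 : ℝ) - 1) * a 0 * b 0 + (k 1 : ℝ) * ((k 1 : ℝ) - 1) * a 1 * b 1) / 2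
        + (k 0 : ℝ) * (k 1 : ℝ) * b 0 * a 1 : ℝ) : ℂ))

/-- `K · (a,b,c,t) = (Ka, Kb, C, t)` for `K ∈ GL(2,ℤ)`, where
`C = ½ (A₁B₁, A₂B₂) + K (c - ½ (a₁b₁, a₂b₂)) + ((b ∧ a)/2) (k₁₁k₁₂, k₂₁k₂₂)`, `A = Ka`, `B = Kb`. -/
def matAct (K : GL (Fin 2) ℤ) : Quad → Quad
  | (a, b, c, t) =>
    ((toReal K.val).mulVec a, (toReal K.val).mulVec b,
      (1 / 2 : ℝ) • coordProd ((toReal K.val).mulVec a) ((toReal K.val).mulVec b)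
        + (toReal K.val).mulVec (c - (1 / 2 : ℝ) • coordProd a b)
        + (wedge b a / 2) • rowProd (toReal K.val),
      t)

/-- `((μ,ρ),(K,k)) · (a,b,c,t) = K · (k · ((μ,ρ) · (a,b,c,t)))`. This is an action of the group
only after passing to the classes `[c]`, `[t]` modulo the lattices `((b ∧ a)/r) ℤ²`,
`((b ∧ a)/r) ℤ`. -/
def act (α : ℝ) (g : GroupElt) (x : Quad) : Quad :=
  matAct g.K (transAct α g.k (scaleAct g.μ g.ρ x))

/-- `x` and `y` have the same components `a`, `b`, and the same classes
`[c] ∈ ℝ² / ((b ∧ a)/r) ℤ²` and `[t] ∈ ℂ / ((b ∧ a)/r) ℤ`. -/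
def SameClass (r : ℕ) : Quad → Quad → Prop
  | (a, b, c, t), (a', b', c', t') =>
    a' = a ∧ b' = b ∧
      (∃ s : Fin 2 → ℤ, c' = c + (wedge b a / (r : ℝ)) • vecReal s) ∧
      (∃ s₀ : ℤ, t' = t + ((wedge b a / (r : ℝ) * (s₀ : ℝ) : ℝ) : ℂ))

/-- The classes `(a,b,[c],[t])` and `(a',b',[c'],[t'])` are in the same orbit. -/
def OrbitRel (α : ℝ) (r : ℕ) (x y : Params α r) : Prop :=
  ∃ g : GroupElt, SameClass r (act α g x.1) y.1

/-- The type II moduli set: the quotient of the space of classes `(a,b,[c],[t])` by the group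
`(ℝ_{>0} × ℝ^*) × (GL(2,ℤ) ⋉ ℤ²)`, with the quotient topology. -/
abbrev Moduli (α : ℝ) (r : ℕ) : Type := Quot (OrbitRel α r)

/-! ### The maps from the moduli set to the set of similarity classes -/

/-- The set of matrices in `SL(2,ℤ)` that have `α` as an eigenvalue. -/
abbrev MatSet (α : ℝ) : Type :=
  {N : Matrix (Fin 2) (Fin 2) ℤ //
    N.det = 1 ∧ Module.End.HasEigenvalue (Matrix.toLin' (toReal N)) α}

/-- `GL(2,ℤ)`-similarity. -/
def Similar (α : ℝ) (N N' : MatSet α) : Prop :=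
  ∃ K : GL (Fin 2) ℤ, N'.1 = K.val * N.1 * K⁻¹.val

/-- The set of similarity classes. -/
abbrev SimClasses (α : ℝ) : Type := Quot (Similar α)

/-- `(a,b)` and `(a',b') = (μ K a, ρ K b)` are in the same orbit. -/
def PairRel (α : ℝ) (x y : Pairs α) : Prop :=
  ∃ g : GroupElt, y.1.1 = g.μ • (toReal g.K.val).mulVec x.1.1 ∧
    y.1.2 = g.ρ • (toReal g.K.val).mulVec x.1.2

/-- The set of orbits of compatible pairs. -/
abbrev PairClasses (α : ℝ) : Type := Quot (PairRel α)

/-- The pair `(a,b)` underlying `(a,b,c,t)`. -/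
def pairOf {α : ℝ} {r : ℕ} (x : Params α r) : Pairs α := ⟨(x.1.1, x.1.2.1), x.2.1⟩

theorem toReal_injective : Function.Injective toReal := by
  intro M M' h
  ext i j
  have := congrFun (congrFun h i) j
  simpa [toReal] using this

theorem toReal_mul (M M' : Matrix (Fin 2) (Fin 2) ℤ) :
    toReal (M * M') = toReal M * toReal M' := by
  ext i j
  simp [toReal, Matrix.mul_apply]

theorem toReal_one : toReal 1 = 1 := by
  ext i j
  by_cases h : i = j <;> simp [toReal, Matrix.one_apply, h]

theorem toReal_det (M : Matrix (Fin 2) (Fin 2) ℤ) : (toReal M).det = (M.det : ℝ) := by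
  simp [toReal, Matrix.det_fin_two]

theorem colMatrix_det_ne {a b : Fin 2 → ℝ} (h : LinearIndependent ℝ ![a, b]) :
    (colMatrix a b).det ≠ 0 := by
  intro h0
  rw [LinearIndependent.pair_iff] at h
  simp only [colMatrix, Matrix.det_fin_two_of] at h0
  have h1 := h (b 1) (-(a 1)) (by
    ext i; fin_cases i
    · simp; linarith
    · simp; ring)
  have h2 := h (b 0) (-(a 0)) (by
    ext i; fin_cases i
    · simp; ring
    · simp; linarith)
  have h3 := h 1 0 (by
    ext i; fin_cases i
    · simpa using h2.2
    · simpa using h1.2)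
  exact one_ne_zero h3.1

/-- The map `(a,b) ↦ N(α,a,b)`; `α ≠ 0` is needed for `det N(α,a,b) = 1`. -/
theorem matN_mem {α : ℝ} (hα : α ≠ 0) {a b : Fin 2 → ℝ} (h : CompatiblePair α a b)
    {M : Matrix (Fin 2) (Fin 2) ℤ} (hM : matN α a b = toReal M) :
    M.det = 1 ∧ Module.End.HasEigenvalue (Matrix.toLin' (toReal M)) α := by
  have hd := colMatrix_det_ne h.1
  have hu : IsUnit (colMatrix a b).det := isUnit_iff_ne_zero.mpr hd
  constructor
  · have h1 : (toReal M).det = 1 := by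
      rw [← hM, matN, Matrix.det_mul, Matrix.det_mul, Matrix.det_nonsing_inv,
        Ring.inverse_eq_inv', Matrix.det_diagonal]
      simp [Fin.prod_univ_two]
      field_simp
    rw [toReal_det] at h1
    exact_mod_cast h1
  · apply Module.End.hasEigenvalue_of_hasEigenvector (x := a)
    refine ⟨Module.End.mem_eigenspace_iff.mpr ?_, ?_⟩
    · have hcol : (colMatrix a b).mulVec ![1, 0] = a := by
        ext i; fin_cases i <;> simp [colMatrix, Matrix.mulVec, dotProduct]
      have hinv : (colMatrix a b)⁻¹.mulVec a = ![1, 0] := by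
        have h2 := congrArg (colMatrix a b)⁻¹.mulVec hcol
        rw [← h2, Matrix.mulVec_mulVec, Matrix.nonsing_inv_mul _ hu, Matrix.one_mulVec]
      have hdiag : (Matrix.diagonal ![α, α⁻¹]).mulVec ![1, 0] = α • (![1, 0] : Fin 2 → ℝ) := by
        ext i; fin_cases i <;> simp [Matrix.mulVec_diagonal]
      rw [Matrix.toLin'_apply, ← hM, matN, ← Matrix.mulVec_mulVec, hinv,
        ← Matrix.mulVec_mulVec, hdiag, Matrix.mulVec_smul, hcol]
    · intro h0
      have := h.1.ne_zero 0
      simp [h0] at this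

theorem matN_orbit {α : ℝ} {a b : Fin 2 → ℝ} (h : CompatiblePair α a b) (g : GroupElt) :
    matN α (g.μ • (toReal g.K.val).mulVec a) (g.ρ • (toReal g.K.val).mulVec b)
      = toReal g.K.val * matN α a b * toReal g.K⁻¹.val := by
  have hd : IsUnit (colMatrix a b).det := isUnit_iff_ne_zero.mpr (colMatrix_det_ne h.1)
  have hK : toReal g.K.val * toReal g.K⁻¹.val = 1 := by
    rw [← toReal_mul, ← toReal_one]; simp
  have hKinv : (toReal g.K.val)⁻¹ = toReal g.K⁻¹.val := Matrix.inv_eq_right_inv hK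
  have hcol : colMatrix (g.μ • (toReal g.K.val).mulVec a) (g.ρ • (toReal g.K.val).mulVec b)
      = toReal g.K.val * colMatrix a b * Matrix.diagonal ![g.μ, g.ρ] := by
    ext i j
    fin_cases i <;> fin_cases j <;>
      simp [colMatrix, Matrix.mul_apply, Fin.sum_univ_two, Matrix.diagonal] <;> ring
  have hS : Matrix.diagonal ![g.μ, g.ρ] * Matrix.diagonal ![α, α⁻¹]
      * (Matrix.diagonal ![g.μ, g.ρ])⁻¹ = Matrix.diagonal ![α, α⁻¹] := by
    have hu : IsUnit (Matrix.diagonal ![g.μ, g.ρ]).det := by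
      rw [Matrix.det_diagonal, isUnit_iff_ne_zero]
      simp [Fin.prod_univ_two, g.μ_pos.ne', g.ρ_ne]
    have hcomm : Matrix.diagonal ![g.μ, g.ρ] * Matrix.diagonal ![α, α⁻¹]
        = Matrix.diagonal ![α, α⁻¹] * Matrix.diagonal ![g.μ, g.ρ] := by
      rw [Matrix.diagonal_mul_diagonal, Matrix.diagonal_mul_diagonal]
      congr 1; ext i; ring
    rw [hcomm, Matrix.mul_assoc, Matrix.mul_nonsing_inv _ hu, Matrix.mul_one]
  rw [matN, hcol, Matrix.mul_inv_rev, Matrix.mul_inv_rev, hKinv, matN]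
  calc _ = toReal g.K.val * colMatrix a b * (Matrix.diagonal ![g.μ, g.ρ]
        * Matrix.diagonal ![α, α⁻¹] * (Matrix.diagonal ![g.μ, g.ρ])⁻¹)
        * ((colMatrix a b)⁻¹ * toReal g.K⁻¹.val) := by simp only [Matrix.mul_assoc]
    _ = _ := by rw [hS]; simp only [Matrix.mul_assoc]

theorem SPlusAdmissible.ne_zero {α : ℝ} (hα : SPlusAdmissible α) : α ≠ 0 := by
  obtain ⟨θ, hθ, rfl⟩ := hα
  have : (3 : ℝ) ≤ (θ : ℝ) := by exact_mod_cast hθ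
  have := Real.sqrt_nonneg ((θ : ℝ) ^ 2 - 4)
  positivity

/-- The map `(a,b) ↦ N(α,a,b)` from compatible pairs to integral matrices. -/
def etaMap {α : ℝ} (hα : SPlusAdmissible α) (x : Pairs α) : MatSet α :=
  ⟨x.2.2.choose, matN_mem hα.ne_zero x.2 x.2.2.choose_spec⟩

theorem etaMap_spec {α : ℝ} (hα : SPlusAdmissible α) (x : Pairs α) :
    toReal (etaMap hα x).1 = matN α x.1.1 x.1.2 := x.2.2.choose_spec.symm

theorem etaMap_similar {α : ℝ} (hα : SPlusAdmissible α) {x y : Pairs α} (h : PairRel α x y) :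
    Similar α (etaMap hα x) (etaMap hα y) := by
  obtain ⟨g, h1, h2⟩ := h
  refine ⟨g.K, toReal_injective ?_⟩
  rw [etaMap_spec, h1, h2, matN_orbit x.2, toReal_mul, toReal_mul, etaMap_spec]

theorem pairRel_of_orbitRel {α : ℝ} {r : ℕ} {x y : Params α r} (h : OrbitRel α r x y) :
    PairRel α (pairOf x) (pairOf y) := by
  obtain ⟨g, h1, h2, -⟩ := h
  refine ⟨g, ?_, ?_⟩
  · simpa [pairOf, Matrix.mulVec_smul] using h1
  · simpa [pairOf, Matrix.mulVec_smul] using h2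

/-- The map `Φ`, `[(a,b,c,t)] ↦ [(a,b)]`. -/
def Phi (α : ℝ) (r : ℕ) : Moduli α r → PairClasses α :=
  Quot.map pairOf (fun _ _ h => pairRel_of_orbitRel h)

/-- The map `Ψ`, `[(a,b,c,t)] ↦ [N(α,a,b)]`. -/
def Psi {α : ℝ} (hα : SPlusAdmissible α) (r : ℕ) : Moduli α r → SimClasses α :=
  Quot.map (fun x => etaMap hα (pairOf x))
    (fun _ _ h => etaMap_similar hα (pairRel_of_orbitRel h))

/-- The fibre of `Φ` over the class of the pair `P = (a,b)`. -/
def fibre {α : ℝ} (r : ℕ) (P : Pairs α) : Set (Moduli α r) := Phi α r ⁻¹' {Quot.mk _ P}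

/-! ### The complex structure -/

/-- The function `F` is holomorphic on the subset `V` of the moduli set: for all `(a,b,c)` the
function `t ↦ F [(a,b,c,t)]` is holomorphic on `{t ∈ ℂ | [(a,b,c,t)] ∈ V}`. For open `V`, these
functions form the structure sheaf of the quotient. -/
def HolomorphicOn {α : ℝ} {r : ℕ} (F : Moduli α r → ℂ) (V : Set (Moduli α r)) : Prop :=
  ∀ (a b c : Fin 2 → ℝ) (h : CompatiblePair α a b ∧ CompatibleVec α r a b c),
    DifferentiableOn ℂ (fun t : ℂ => F (Quot.mk _ ⟨(a, b, c, t), h⟩))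
      {t : ℂ | Quot.mk (OrbitRel α r) ⟨(a, b, c, t), h⟩ ∈ V}

/-- The subspace `S` of the moduli set is biholomorphic to the complex manifold `Y`: there is a
homeomorphism `S ≃ Y` which identifies the holomorphic functions on open subsets. -/
def Biholomorphic {α : ℝ} {r : ℕ} (S : Set (Moduli α r)) (Y : Type)
    [TopologicalSpace Y] [ChartedSpace ℂ Y] : Prop :=
  ∃ e : S ≃ₜ Y, ∀ W : Set Y, IsOpen W → ∀ F : Moduli α r → ℂ,
    (HolomorphicOn F (Subtype.val '' (e ⁻¹' W)) ↔
      MDifferentiableOn 𝓘(ℂ, ℂ) 𝓘(ℂ, ℂ) (fun y : Y => F (e.symm y : S)) W)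

/-! ### The stabiliser, its orbits, and condition (C) -/

/-- The stabiliser of `(a,b)`. -/
def pairStab (a b : Fin 2 → ℝ) : Set GroupElt :=
  {g | g.μ • (toReal g.K.val).mulVec a = a ∧ g.ρ • (toReal g.K.val).mulVec b = b}

/-- `[c']` is the image of `[c]` under the element `g` of the stabiliser of `(a,b)`. -/
def MovesClass (α : ℝ) (r : ℕ) (a b : Fin 2 → ℝ) (g : GroupElt) (c c' : Fin 2 → ℝ) : Prop :=
  ∃ s : Fin 2 → ℤ, c' = (act α g (a, b, c, 0)).2.2.1 + (wedge b a / (r : ℝ)) • vecReal s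

/-- The subset of the moduli set associated with the orbit of `[c]` under the stabiliser of
`(a,b)`: the set of all `[(a,b,c',t)]` with `[c']` in this orbit. -/
def orbitPart (α : ℝ) (r : ℕ) (a b c : Fin 2 → ℝ) : Set (Moduli α r) :=
  {q | ∃ x : Params α r, q = Quot.mk _ x ∧ x.1.1 = a ∧ x.1.2.1 = b ∧
    ∃ g ∈ pairStab a b, MovesClass α r a b g c x.1.2.2.1}

/-- The lattice `((b ∧ a)/r) ℤ` in `ℂ`. -/
def lattice (r : ℕ) (a b : Fin 2 → ℝ) : AddSubgroup ℂ :=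
  AddSubgroup.zmultiples ((wedge b a / (r : ℝ) : ℝ) : ℂ)

/-- The cylinder `ℂ / ((b ∧ a)/r) ℤ`. -/
abbrev Cyl (r : ℕ) (a b : Fin 2 → ℝ) : Type := ℂ ⧸ lattice r a b

/-- The image, in the group of bijections of the cylinder, of the stabiliser of `[c]` in the
stabiliser of `(a,b)`. -/
def stabImage (α : ℝ) (r : ℕ) (a b c : Fin 2 → ℝ) : Set (Equiv.Perm (Cyl r a b)) :=
  {h | ∃ g ∈ pairStab a b, MovesClass α r a b g c c ∧
    ∀ t : ℂ, h (QuotientAddGroup.mk t) = QuotientAddGroup.mk (act α g (a, b, c, t)).2.2.2}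

/-- The group generated by the translations of the cylinder by torsion elements and the inversion
`x ↦ -x`. -/
def torsionGroup (r : ℕ) (a b : Fin 2 → ℝ) : Subgroup (Equiv.Perm (Cyl r a b)) :=
  Subgroup.closure
    ({h | ∃ τ : Cyl r a b, IsOfFinAddOrder τ ∧ h = Equiv.addRight τ} ∪ {Equiv.neg _})

/-- `h` has the form `x ↦ -x + τ`. Every element of the group `torsionGroup` is a map
`x ↦ ε x + τ` with `ε = ±1`, and it interchanges the two ends of the cylinder when `ε = -1`. -/
def SwapsEnds {r : ℕ} {a b : Fin 2 → ℝ} (h : Equiv.Perm (Cyl r a b)) : Prop :=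
  ∃ τ : Cyl r a b, ∀ x, h x = -x + τ

/-- `L` is in the positive centraliser of `N` in `GL(2,ℤ)`, where `a` is an eigenvector of `N` for
the eigenvalue `α > 1`: `LN = NL` and `La ∈ ℝ_{>0} a`. -/
def PosCentraliser (N : Matrix (Fin 2) (Fin 2) ℤ) (a : Fin 2 → ℝ) (L : GL (Fin 2) ℤ) : Prop :=
  L.val * N = N * L.val ∧ ∃ ϑ : ℝ, 0 < ϑ ∧ (toReal L.val).mulVec a = ϑ • a

/-- Condition (C): `(I + L) p ∈ r ℤ² + (I - N) ℤ²` for some `L` in the positive centraliser of `N`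
with `det L = -1`. -/
def ConditionC (N : Matrix (Fin 2) (Fin 2) ℤ) (r : ℕ) (a : Fin 2 → ℝ) (p : Fin 2 → ℤ) : Prop :=
  ∃ L : GL (Fin 2) ℤ, PosCentraliser N a L ∧ L.val.det = -1 ∧
    ∃ u v : Fin 2 → ℤ, (1 + L.val).mulVec p = (r : ℤ) • u + (1 - N).mulVec v

end InoueII

end

/-!
The group acts on `t` by real affine maps `t ↦ ε t + τ`, where `ε = μρ`, and the fibre over the
class of `(a,b)` is covered by the slices `t ↦ [(a,b,c,t)]`, one for every compatible `c`.

*Slices.* The quotient map onto the moduli set is open, because the group and the lattices act on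
the parameters by homeomorphisms (`isOpenMap_mk`). The matrix `N(α,a,b)` and the vector `π(c)` are
continuous and have integral values, so every `(a',b',c',t')` near `(a,b,c,t)` has the same `N`
and the same `π`. Hence it equals `(μ a, ρ b, μρ c, t')` for some `μ > 0` and `ρ ≠ 0`, and
represents a point of the slice. So each slice is an open map to the moduli set
(`isOpenMap_slice`). Two slices over `(a,b)` coincide or are disjoint, therefore they are the
connected components of the fibre (`connectedComponentIn_fibre`), and a component is `ℂ` modulo
the group of all `t ↦ ε t + τ` that come from the stabiliser of `(a,b,[c])` (`Moves`).

*The affine group.* In the stabiliser of `(a,b)`, `ε = det K = ±1`. The lengths `τ` are rational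
multiples of `b ∧ a` with a common denominator (`shift_denominator`). So the translations form a
lattice `l ℤ` with `l ≠ 0` (`exists_translations_eq`), and the image `H` of the stabiliser in the
bijections of the cylinder is a finite set of maps `x ↦ ±x + τ` with torsion elements `τ`. The
group element acts on `p = π(c)` by `p ↦ (det K) K (p + r (-k₂, k₁))` modulo `r ℤ²`, and `[c]` is
determined by `p` modulo `(I - N) ℤ²` (`HasPi.act`, `HasPi.class_iff`). Thus `ε = -1` occurs in
the stabiliser of `[c]` exactly under condition (C) (`conditionC_iff_moves`).

*The quotients.* If only translations occur, `t ↦ exp (2πi t / l)` identifies the component with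
`ℂˣ`; if an inversion about `τ₀ / 2` occurs, `t ↦ cos (2π (t - τ₀ / 2) / l)` identifies it with
`ℂ`. In the second case the critical values `±1` of the cosine are removable singularities. Since
there is no continuous logarithm on `ℂˣ`, the two cases exclude each other
(`not_homeomorph_units`).
-/

namespace InoueII

/-! ### The group action on classes -/

/-- Modulo `2`, the product of the two entries of `(x, y) K` is a linear combination of the row
products of `K` and of `(det K) x y`, because `x² ≡ x`. Multiplied by `(b ∧ a)/2`, this congruence
accounts for the half-integral terms in the action of `K`. -/
theorem row_mul_parity (x y k₀₀ k₀₁ k₁₀ k₁₁ : ℤ) :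
    ∃ q : ℤ, (x * k₀₀ + y * k₁₀) * (x * k₀₁ + y * k₁₁)
      = x * (k₀₀ * k₀₁) + y * (k₁₀ * k₁₁) + (k₀₀ * k₁₁ - k₀₁ * k₁₀) * (x * y) + 2 * q := by
  obtain ⟨m, hm⟩ := Int.even_mul_pred_self x
  obtain ⟨n, hn⟩ := Int.even_mul_pred_self y
  refine ⟨m * (k₀₀ * k₀₁) + n * (k₁₀ * k₁₁) + x * y * (k₀₁ * k₁₀), ?_⟩
  linear_combination (k₀₀ * k₀₁) * hm + (k₁₀ * k₁₁) * hn

theorem GL_det_sq (K : GL (Fin 2) ℤ) : K.val.det * K.val.det = 1 := by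
  have h := (Matrix.isUnit_iff_isUnit_det _).mp K.isUnit
  rcases Int.isUnit_iff.mp h with h | h <;> simp [h]

theorem toReal_mulVec_apply (M : Matrix (Fin 2) (Fin 2) ℤ) (v : Fin 2 → ℝ) (i : Fin 2) :
    (toReal M).mulVec v i = (M i 0 : ℝ) * v 0 + (M i 1 : ℝ) * v 1 := by
  simp [toReal, Matrix.mulVec, dotProduct]

theorem rowProd_toReal (M : Matrix (Fin 2) (Fin 2) ℤ) (i : Fin 2) :
    rowProd (toReal M) i = (M i 0 : ℝ) * (M i 1 : ℝ) := rfl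

theorem add_ofReal_eq {x y z : ℝ} (t : ℂ) (h : x = y + z) :
    t + (x : ℂ) = t + (y : ℂ) + (z : ℂ) := by
  rw [h]; push_cast; ring

theorem wedge_mulVec (M : Matrix (Fin 2) (Fin 2) ℤ) (a b : Fin 2 → ℝ) :
    wedge ((toReal M).mulVec b) ((toReal M).mulVec a) = (M.det : ℝ) * wedge b a := by
  simp [wedge, toReal, Matrix.mulVec, dotProduct, Matrix.det_fin_two]
  ring

theorem wedge_smul (μ ρ : ℝ) (a b : Fin 2 → ℝ) :
    wedge (ρ • b) (μ • a) = μ * ρ * wedge b a := by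
  simp [wedge]; ring

namespace GroupElt

@[ext] theorem ext' {g h : GroupElt} (h1 : g.μ = h.μ) (h2 : g.ρ = h.ρ) (h3 : g.K = h.K)
    (h4 : g.k = h.k) : g = h := by
  cases g; cases h; simp_all

/-- The product in `(ℝ_{>0} × ℝ^*) × (GL(2,ℤ) ⋉ ℤ²)`, for which `K · k = (k K⁻¹) · K`. -/
noncomputable instance : Mul GroupElt where
  mul g h :=
    { μ := g.μ * h.μ, ρ := g.ρ * h.ρ, K := g.K * h.K, k := h.k + Matrix.vecMul g.k h.K.val
      μ_pos := mul_pos g.μ_pos h.μ_pos, ρ_ne := mul_ne_zero g.ρ_ne h.ρ_ne }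

noncomputable instance : One GroupElt where
  one := { μ := 1, ρ := 1, K := 1, k := 0, μ_pos := one_pos, ρ_ne := one_ne_zero }

noncomputable instance : Inv GroupElt where
  inv g :=
    { μ := g.μ⁻¹, ρ := g.ρ⁻¹, K := g.K⁻¹, k := -Matrix.vecMul g.k g.K⁻¹.val
      μ_pos := inv_pos.mpr g.μ_pos, ρ_ne := inv_ne_zero g.ρ_ne }

@[simp] theorem mul_μ (g h : GroupElt) : (g * h).μ = g.μ * h.μ := rfl
@[simp] theorem mul_ρ (g h : GroupElt) : (g * h).ρ = g.ρ * h.ρ := rfl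
@[simp] theorem mul_k (g h : GroupElt) : (g * h).k = h.k + Matrix.vecMul g.k h.K.val := rfl
@[simp] theorem one_μ : (1 : GroupElt).μ = 1 := rfl
@[simp] theorem one_ρ : (1 : GroupElt).ρ = 1 := rfl
@[simp] theorem one_K : (1 : GroupElt).K = 1 := rfl
@[simp] theorem one_k : (1 : GroupElt).k = 0 := rfl
@[simp] theorem inv_μ (g : GroupElt) : (g⁻¹).μ = g.μ⁻¹ := rfl
@[simp] theorem inv_ρ (g : GroupElt) : (g⁻¹).ρ = g.ρ⁻¹ := rfl
@[simp] theorem inv_K (g : GroupElt) : (g⁻¹).K = g.K⁻¹ := rfl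
@[simp] theorem inv_k (g : GroupElt) : (g⁻¹).k = -Matrix.vecMul g.k g.K⁻¹.val := rfl

theorem inv_mul (g : GroupElt) : g⁻¹ * g = 1 := by
  apply ext'
  · simp [g.μ_pos.ne']
  · simp [g.ρ_ne]
  · exact inv_mul_cancel g.K
  · have h : g.K⁻¹.val * g.K.val = 1 := by rw [← Units.val_mul]; simp
    rw [mul_k, inv_k, Matrix.neg_vecMul, Matrix.vecMul_vecMul, h]
    simp

end GroupElt

theorem SameClass.refl (r : ℕ) (x : Quad) : SameClass r x x := by
  obtain ⟨a, b, c, t⟩ := x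
  exact ⟨rfl, rfl, ⟨0, by ext; simp [vecReal]⟩, ⟨0, by simp⟩⟩

theorem SameClass.symm {r : ℕ} {x y : Quad} (h : SameClass r x y) : SameClass r y x := by
  obtain ⟨a, b, c, t⟩ := x
  obtain ⟨a', b', c', t'⟩ := y
  obtain ⟨rfl, rfl, ⟨s, rfl⟩, ⟨s₀, rfl⟩⟩ := h
  exact ⟨rfl, rfl, ⟨-s, by ext; simp [vecReal]⟩, ⟨-s₀, by push_cast; ring⟩⟩

theorem SameClass.trans {r : ℕ} {x y z : Quad} (h : SameClass r x y) (h' : SameClass r y z) :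
    SameClass r x z := by
  obtain ⟨a, b, c, t⟩ := x
  obtain ⟨a', b', c', t'⟩ := y
  obtain ⟨a'', b'', c'', t''⟩ := z
  obtain ⟨rfl, rfl, ⟨s, rfl⟩, ⟨s₀, rfl⟩⟩ := h
  obtain ⟨rfl, rfl, ⟨s', rfl⟩, ⟨s₀', rfl⟩⟩ := h'
  exact ⟨rfl, rfl, ⟨s + s', by ext; simp [vecReal]; ring⟩, ⟨s₀ + s₀', by push_cast; ring⟩⟩

theorem SameClass.of_eq {r : ℕ} {x y : Quad} (h : x = y) : SameClass r x y :=
  h ▸ SameClass.refl r x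

theorem SameClass.scale {r : ℕ} {x y : Quad} (h : SameClass r x y) (μ ρ : ℝ) :
    SameClass r (scaleAct μ ρ x) (scaleAct μ ρ y) := by
  obtain ⟨a, b, c, t⟩ := x
  obtain ⟨a', b', c', t'⟩ := y
  obtain ⟨rfl, rfl, ⟨s, rfl⟩, ⟨s₀, rfl⟩⟩ := h
  refine ⟨rfl, rfl, ⟨s, ?_⟩, ⟨s₀, ?_⟩⟩
  · rw [wedge_smul]; ext; simp [vecReal]; ring
  · rw [wedge_smul]; push_cast; ring

theorem SameClass.transl {r : ℕ} {x y : Quad} (h : SameClass r x y) (α : ℝ) (k : Fin 2 → ℤ) :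
    SameClass r (transAct α k x) (transAct α k y) := by
  obtain ⟨a, b, c, t⟩ := x
  obtain ⟨a', b', c', t'⟩ := y
  obtain ⟨rfl, rfl, ⟨s, rfl⟩, ⟨s₀, rfl⟩⟩ := h
  refine ⟨rfl, rfl, ⟨s, ?_⟩, ⟨s₀ + (k 0 * s 0 + k 1 * s 1), ?_⟩⟩
  · ext; simp; ring
  · simp only [rowMul, vecReal, Pi.add_apply, Pi.smul_apply, smul_eq_mul]; push_cast; ring

theorem SameClass.mat {r : ℕ} {x y : Quad} (h : SameClass r x y) (K : GL (Fin 2) ℤ) :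
    SameClass r (matAct K x) (matAct K y) := by
  obtain ⟨a, b, c, t⟩ := x
  obtain ⟨a', b', c', t'⟩ := y
  obtain ⟨rfl, rfl, ⟨s, rfl⟩, ⟨s₀, rfl⟩⟩ := h
  have hd := GL_det_sq K
  refine ⟨rfl, rfl, ⟨K.val.det • K.val.mulVec s, ?_⟩, ⟨K.val.det * s₀, ?_⟩⟩
  -- `K` multiplies `b ∧ a` by `det K = ±1`, which is its own inverse
  · rw [wedge_mulVec]
    generalize K.val.det = d at hd
    have hd' : (d : ℝ) * d = 1 := by exact_mod_cast hd
    ext i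
    simp only [Pi.add_apply, Pi.smul_apply, smul_eq_mul, toReal_mulVec_apply, Pi.sub_apply, vecReal]
    simp only [Matrix.mulVec, dotProduct, Fin.sum_univ_two]
    push_cast
    linear_combination (-(wedge b' a' / r) * (K.val i 0 * s 0 + K.val i 1 * s 1) : ℝ) * hd'
  · rw [wedge_mulVec]
    generalize K.val.det = d at hd
    have hd' : (d : ℂ) * d = 1 := by exact_mod_cast hd
    push_cast
    linear_combination (-(wedge b' a' / r * s₀) : ℂ) * hd'

theorem SameClass.act {r : ℕ} {x y : Quad} (h : SameClass r x y) (α : ℝ) (g : GroupElt) :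
    SameClass r (act α g x) (act α g y) :=
  ((h.scale g.μ g.ρ).transl α g.k).mat g.K

theorem scaleAct_scaleAct (μ ρ μ' ρ' : ℝ) (x : Quad) :
    scaleAct μ' ρ' (scaleAct μ ρ x) = scaleAct (μ' * μ) (ρ' * ρ) x := by
  obtain ⟨a, b, c, t⟩ := x
  simp only [scaleAct, smul_smul, Prod.mk.injEq, true_and]
  refine ⟨by congr 1; ring, by push_cast; ring⟩

theorem scaleAct_transAct (α μ ρ : ℝ) (k : Fin 2 → ℤ) (x : Quad) :
    scaleAct μ ρ (transAct α k x) = transAct α k (scaleAct μ ρ x) := by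
  obtain ⟨a, b, c, t⟩ := x
  simp only [scaleAct, transAct, Prod.mk.injEq, true_and, rowMul, Pi.smul_apply, smul_eq_mul]
  refine ⟨by ext; simp; ring, by push_cast; ring⟩

theorem scaleAct_matAct (μ ρ : ℝ) (K : GL (Fin 2) ℤ) (x : Quad) :
    scaleAct μ ρ (matAct K x) = matAct K (scaleAct μ ρ x) := by
  obtain ⟨a, b, c, t⟩ := x
  simp only [scaleAct, matAct, Matrix.mulVec_smul, Prod.mk.injEq, true_and, wedge_smul, and_true]
  ext i
  simp only [Pi.add_apply, Pi.smul_apply, smul_eq_mul, toReal_mulVec_apply, coordProd,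
    Pi.sub_apply]
  ring

/-- The two sides differ by `k'₁ k₂ (b ∧ a)` in the coordinate `t`. -/
theorem transAct_transAct {α : ℝ} (hα : α ≠ 1) {r : ℕ} (hr : r ≠ 0) (k k' : Fin 2 → ℤ) (x : Quad) :
    SameClass r (transAct α k' (transAct α k x)) (transAct α (k + k') x) := by
  obtain ⟨a, b, c, t⟩ := x
  have h1 : α - 1 ≠ 0 := sub_ne_zero.mpr hα
  have h2 : (1 - α : ℝ) = -(α - 1) := by ring
  have hr' : (r : ℝ) ≠ 0 := by exact_mod_cast hr
  refine ⟨rfl, rfl, ⟨0, ?_⟩, ⟨r * (k' 0 * k 1), ?_⟩⟩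
  · ext i; simp [rowMul, vecReal]; field_simp; ring
  · rw [add_assoc t, ← Complex.ofReal_add]
    refine add_ofReal_eq t ?_
    simp only [rowMul, wedge, Pi.add_apply, Pi.sub_apply, Pi.smul_apply, smul_eq_mul]
    push_cast
    rw [h2]
    field_simp
    ring

/-- The two sides differ in `t` by an integral multiple of `b ∧ a`, by `row_mul_parity`. -/
theorem transAct_matAct {α : ℝ} {r : ℕ} (hr : r ≠ 0) (k : Fin 2 → ℤ) (K : GL (Fin 2) ℤ) (x : Quad) :
    SameClass r (transAct α k (matAct K x)) (matAct K (transAct α (Matrix.vecMul k K.val) x)) := by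
  obtain ⟨a, b, c, t⟩ := x
  have hr' : (r : ℝ) ≠ 0 := by exact_mod_cast hr
  obtain ⟨q, hq⟩ := row_mul_parity (k 0) (k 1) (K.val 0 0) (K.val 0 1) (K.val 1 0) (K.val 1 1)
  have hd := GL_det_sq K
  have hq' : (_ : ℝ) = _ := congrArg (fun z : ℤ => (z : ℝ)) hq
  refine ⟨rfl, rfl, ⟨0, ?_⟩, ⟨r * (K.val.det * q), ?_⟩⟩
  · ext i
    simp only [rowMul, vecReal, Matrix.vecMul, dotProduct, Fin.sum_univ_two, coordProd,
      Pi.add_apply, Pi.smul_apply, smul_eq_mul, toReal_mulVec_apply, Pi.sub_apply, Pi.zero_apply]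
    push_cast
    ring
  · refine add_ofReal_eq t ?_
    have e : wedge ((toReal K.val).mulVec b) ((toReal K.val).mulVec a) / (r : ℝ)
        * ((r * (K.val.det * q) : ℤ) : ℝ) = wedge b a * q := by
      rw [wedge_mulVec]
      generalize K.val.det = d at hd
      have hd' : (d : ℝ) * d = 1 := by exact_mod_cast hd
      push_cast; field_simp
      linear_combination (wedge b a * q) * hd'
    rw [e]
    push_cast at hq'
    simp only [rowMul, wedge, Pi.add_apply, Pi.sub_apply, Pi.smul_apply, smul_eq_mul,
      toReal_mulVec_apply, rowProd_toReal, dotProduct, Fin.sum_univ_two, Matrix.vecMul, coordProd]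
    push_cast
    linear_combination ((b 0 * a 1 - b 1 * a 0) / 2) * hq'

/-- The two sides differ in `c` by an integral multiple of `b ∧ a`, by `row_mul_parity`. -/
theorem matAct_matAct {r : ℕ} (hr : r ≠ 0) (K K' : GL (Fin 2) ℤ) (x : Quad) :
    SameClass r (matAct K' (matAct K x)) (matAct (K' * K) x) := by
  obtain ⟨a, b, c, t⟩ := x
  have hr' : (r : ℝ) ≠ 0 := by exact_mod_cast hr
  have hq := fun i => row_mul_parity (K'.val i 0) (K'.val i 1) (K.val 0 0) (K.val 0 1)
    (K.val 1 0) (K.val 1 1)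
  choose q hq using hq
  have hd := GL_det_sq (K' * K)
  refine ⟨?_, ?_, ⟨(r * (K' * K).val.det) • q, ?_⟩, ⟨0, ?_⟩⟩
  · rw [Matrix.mulVec_mulVec, ← toReal_mul, ← Units.val_mul]
  · rw [Matrix.mulVec_mulVec, ← toReal_mul, ← Units.val_mul]
  · rw [Matrix.mulVec_mulVec, Matrix.mulVec_mulVec, ← toReal_mul, ← Units.val_mul]
    have e : (wedge ((toReal (K' * K).val).mulVec b) ((toReal (K' * K).val).mulVec a) / (r : ℝ))
        • vecReal ((r * (K' * K).val.det) • q) = wedge b a • vecReal q := by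
      rw [wedge_mulVec]
      generalize (K' * K).val.det = d at hd
      have hd' : (d : ℝ) * d = 1 := by exact_mod_cast hd
      ext i
      simp only [vecReal, Pi.smul_apply, smul_eq_mul]
      push_cast
      field_simp
      linear_combination (wedge b a * q i) * hd'
    rw [e]
    ext i
    have hq' : (_ : ℝ) = _ := congrArg (fun z : ℤ => (z : ℝ)) (hq i)
    push_cast at hq'
    simp only [wedge, Pi.add_apply, Pi.sub_apply, Pi.smul_apply, smul_eq_mul,
      toReal_mulVec_apply, rowProd_toReal, Fin.sum_univ_two,
      coordProd, Units.val_mul, Matrix.mul_apply, vecReal]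
    push_cast
    linear_combination ((b 0 * a 1 - b 1 * a 0) / 2) * hq'
  · simp

/-- The formulas for the action are compatible with the group law up to the lattices
`((b ∧ a)/r) ℤ²` and `((b ∧ a)/r) ℤ`. -/
theorem act_act {α : ℝ} (hα : α ≠ 1) {r : ℕ} (hr : r ≠ 0) (g h : GroupElt) (x : Quad) :
    SameClass r (act α g (act α h x)) (act α (g * h) x) := by
  unfold act
  rw [scaleAct_matAct, scaleAct_transAct, scaleAct_scaleAct]
  refine ((transAct_matAct hr _ _ _).mat _).trans ?_
  refine (matAct_matAct hr _ _ _).trans ?_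
  exact (transAct_transAct hα hr _ _ _).mat _

theorem transAct_zero (α : ℝ) (x : Quad) : transAct α 0 x = x := by
  obtain ⟨a, b, c, t⟩ := x
  simp [transAct, rowMul]

theorem matAct_one (x : Quad) : matAct 1 x = x := by
  obtain ⟨a, b, c, t⟩ := x
  have h1 : (1 : GL (Fin 2) ℤ).val = 1 := rfl
  simp only [matAct, h1, toReal_one, Matrix.one_mulVec]
  refine Prod.ext rfl (Prod.ext rfl (Prod.ext ?_ rfl))
  ext i; fin_cases i <;> simp [rowProd]

theorem act_scale (α μ ρ : ℝ) (hμ : 0 < μ) (hρ : ρ ≠ 0) (x : Quad) :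
    act α ⟨μ, ρ, 1, 0, hμ, hρ⟩ x = scaleAct μ ρ x := by
  rw [act, transAct_zero, matAct_one]

theorem act_one (α : ℝ) (x : Quad) : act α 1 x = x := by
  obtain ⟨a, b, c, t⟩ := x
  refine (act_scale α 1 1 one_pos one_ne_zero _).trans ?_
  simp [scaleAct]

theorem act_inv_act {α : ℝ} (hα : α ≠ 1) {r : ℕ} (hr : r ≠ 0) (g : GroupElt) (x : Quad) :
    SameClass r (act α g⁻¹ (act α g x)) x := by
  have := act_act hα hr g⁻¹ g x
  rwa [GroupElt.inv_mul, act_one] at this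

theorem SameClass.act_symm {α : ℝ} (hα : α ≠ 1) {r : ℕ} (hr : r ≠ 0) {g : GroupElt} {x y : Quad}
    (h : SameClass r (InoueII.act α g x) y) : SameClass r (InoueII.act α g⁻¹ y) x :=
  (h.act α g⁻¹).symm.trans (act_inv_act hα hr g x)

theorem SameClass.act_trans {α : ℝ} (hα : α ≠ 1) {r : ℕ} (hr : r ≠ 0) {g h : GroupElt}
    {x y z : Quad} (h₁ : SameClass r (InoueII.act α g x) y)
    (h₂ : SameClass r (InoueII.act α h y) z) : SameClass r (InoueII.act α (h * g) x) z :=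
  (act_act hα hr h g x).symm.trans ((h₁.act α h).trans h₂)

theorem orbitRel_equivalence {α : ℝ} (hα : α ≠ 1) {r : ℕ} (hr : r ≠ 0) :
    Equivalence (OrbitRel α r) where
  refl x := ⟨1, SameClass.of_eq (act_one α x.1)⟩
  symm := fun ⟨g, h⟩ => ⟨g⁻¹, h.act_symm hα hr⟩
  trans := fun ⟨g, h⟩ ⟨g', h'⟩ => ⟨g' * g, h.act_trans hα hr h'⟩

theorem mk_eq_mk_iff {α : ℝ} (hα : α ≠ 1) {r : ℕ} (hr : r ≠ 0) {x y : Params α r} :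
    (Quot.mk (OrbitRel α r) x : Moduli α r) = Quot.mk (OrbitRel α r) y ↔ OrbitRel α r x y :=
  (orbitRel_equivalence hα hr).quot_mk_eq_iff x y

/-! ### Compatible pairs and their eigenvectors -/

theorem SPlusAdmissible.exists_trace {α : ℝ} (hα : SPlusAdmissible α) :
    ∃ θ : ℤ, 3 ≤ θ ∧ α * α = θ * α - 1 ∧ 1 < α := by
  obtain ⟨θ, hθ, rfl⟩ := hα
  have h3 : (3 : ℝ) ≤ (θ : ℝ) := by exact_mod_cast hθ
  have h0 := Real.sqrt_nonneg ((θ : ℝ) ^ 2 - 4)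
  have hs := Real.mul_self_sqrt (show (0 : ℝ) ≤ (θ : ℝ) ^ 2 - 4 by nlinarith)
  refine ⟨θ, by exact_mod_cast hθ, ?_, by linarith⟩
  push_cast
  linear_combination hs / 4

theorem SPlusAdmissible.one_lt {α : ℝ} (hα : SPlusAdmissible α) : 1 < α := by
  obtain ⟨_, _, _, h⟩ := hα.exists_trace
  exact h

theorem SPlusAdmissible.ne_one {α : ℝ} (hα : SPlusAdmissible α) : α ≠ 1 := hα.one_lt.ne'

theorem wedge_ne_zero {a b : Fin 2 → ℝ} (h : LinearIndependent ℝ ![a, b]) : wedge b a ≠ 0 := by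
  have := colMatrix_det_ne h
  simp only [colMatrix, Matrix.det_fin_two_of] at this
  intro h0
  apply this
  unfold wedge at h0
  linarith

theorem linearIndependent_of_wedge_ne_zero {a b : Fin 2 → ℝ} (h : wedge b a ≠ 0) :
    LinearIndependent ℝ ![a, b] := by
  rw [LinearIndependent.pair_iff]
  intro s t hst
  have h0 := congrFun hst 0
  have h1 := congrFun hst 1
  simp only [Pi.add_apply, Pi.smul_apply, smul_eq_mul, Pi.zero_apply] at h0 h1
  have e1 : s * wedge b a = 0 := by unfold wedge; linear_combination (b 0) * h1 - (b 1) * h0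
  have e2 : t * wedge b a = 0 := by unfold wedge; linear_combination (a 1) * h0 - (a 0) * h1
  exact ⟨(mul_eq_zero.mp e1).resolve_right h, (mul_eq_zero.mp e2).resolve_right h⟩

theorem matN_apply (α : ℝ) {a b : Fin 2 → ℝ} (h : wedge b a ≠ 0) :
    matN α a b = !![(α⁻¹ * b 0 * a 1 - α * a 0 * b 1) / wedge b a,
        (α * a 0 * b 0 - α⁻¹ * b 0 * a 0) / wedge b a;
        (α⁻¹ * b 1 * a 1 - α * a 1 * b 1) / wedge b a,
        (α * a 1 * b 0 - α⁻¹ * b 1 * a 0) / wedge b a] := by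
  have hd : (colMatrix a b).det = - wedge b a := by
    simp [colMatrix, Matrix.det_fin_two_of, wedge]; ring
  have hD : Matrix.diagonal ![α, α⁻¹] = !![α, 0; 0, α⁻¹] := by
    ext i j; fin_cases i <;> fin_cases j <;> simp
  rw [matN, Matrix.inv_def, hd, Ring.inverse_eq_inv', colMatrix, Matrix.adjugate_fin_two_of, hD]
  generalize α⁻¹ = β
  ext i j
  fin_cases i <;> fin_cases j <;>
    simp [Matrix.mul_apply, Fin.sum_univ_two] <;> field_simp <;> ring

theorem matN_mulVec_fst (α : ℝ) {a b : Fin 2 → ℝ} (h : wedge b a ≠ 0) :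
    (matN α a b).mulVec a = α • a := by
  rw [matN_apply α h]
  generalize α⁻¹ = β
  ext i
  fin_cases i <;> simp [Matrix.mulVec, dotProduct, Fin.sum_univ_two] <;> field_simp <;>
    unfold wedge <;> ring

theorem matN_mulVec_snd (α : ℝ) {a b : Fin 2 → ℝ} (h : wedge b a ≠ 0) :
    (matN α a b).mulVec b = α⁻¹ • b := by
  rw [matN_apply α h]
  generalize α⁻¹ = β
  ext i
  fin_cases i <;> simp [Matrix.mulVec, dotProduct, Fin.sum_univ_two] <;> field_simp <;>
    unfold wedge <;> ring

theorem eq_matN {α : ℝ} {a b : Fin 2 → ℝ} (h : wedge b a ≠ 0) {M : Matrix (Fin 2) (Fin 2) ℝ}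
    (ha : M.mulVec a = α • a) (hb : M.mulVec b = α⁻¹ • b) : matN α a b = M := by
  have hd : IsUnit (colMatrix a b).det :=
    isUnit_iff_ne_zero.mpr (colMatrix_det_ne (linearIndependent_of_wedge_ne_zero h))
  have e : M * colMatrix a b = colMatrix a b * Matrix.diagonal ![α, α⁻¹] := by
    ext i j
    have h1 := congrFun ha i
    have h2 := congrFun hb i
    simp only [Matrix.mulVec, dotProduct, Fin.sum_univ_two, Pi.smul_apply, smul_eq_mul] at h1 h2
    fin_cases j
    · fin_cases i <;>
        simp_all [colMatrix, Matrix.mul_apply, Fin.sum_univ_two, Matrix.diagonal, mul_comm]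
    · fin_cases i <;>
        simp_all [colMatrix, Matrix.mul_apply, Fin.sum_univ_two, Matrix.diagonal, mul_comm]
  rw [matN, ← e, Matrix.mul_assoc, Matrix.mul_nonsing_inv _ hd, Matrix.mul_one]

theorem det_one_sub_matN {α : ℝ} (h0 : α ≠ 0) (h1 : α ≠ 1) {a b : Fin 2 → ℝ}
    (h : wedge b a ≠ 0) : (1 - matN α a b).det ≠ 0 := by
  have e : (1 - matN α a b).det = -((α - 1) * (α - 1) / α) := by
    rw [matN_apply α h, Matrix.one_fin_two, Matrix.det_fin_two]
    simp
    field_simp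
    unfold wedge
    ring
  rw [e]
  have := sub_ne_zero.mpr h1
  exact neg_ne_zero.mpr (div_ne_zero (mul_ne_zero this this) h0)

theorem CompatiblePair.orbit {α : ℝ} {a b : Fin 2 → ℝ} (h : CompatiblePair α a b) (g : GroupElt) :
    CompatiblePair α (g.μ • (toReal g.K.val).mulVec a) (g.ρ • (toReal g.K.val).mulVec b) := by
  obtain ⟨M, hM⟩ := h.2
  refine ⟨linearIndependent_of_wedge_ne_zero ?_, g.K.val * M * g.K⁻¹.val, ?_⟩
  · rw [wedge_smul, wedge_mulVec]
    have hd : (g.K.val.det : ℝ) ≠ 0 := by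
      have := GL_det_sq g.K
      intro h0
      have h0' : g.K.val.det = 0 := by exact_mod_cast h0
      simp [h0'] at this
    exact mul_ne_zero (mul_ne_zero g.μ_pos.ne' g.ρ_ne) (mul_ne_zero hd (wedge_ne_zero h.1))
  · rw [matN_orbit h, hM, toReal_mul, toReal_mul]

theorem matN_smul (α : ℝ) {a b : Fin 2 → ℝ} (h : wedge b a ≠ 0) {μ ρ : ℝ} (hμ : μ ≠ 0)
    (hρ : ρ ≠ 0) : matN α (μ • a) (ρ • b) = matN α a b := by
  apply eq_matN
  · rw [wedge_smul]; exact mul_ne_zero (mul_ne_zero hμ hρ) h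
  · rw [Matrix.mulVec_smul, matN_mulVec_fst α h, smul_comm]
  · rw [Matrix.mulVec_smul, matN_mulVec_snd α h, smul_comm]

/-! ### The invariant `π` under the action -/

theorem HasPi.scale {α : ℝ} {r : ℕ} {a b c : Fin 2 → ℝ} {p : Fin 2 → ℤ} (h : wedge b a ≠ 0)
    (hp : HasPi α r a b c p) {μ ρ : ℝ} (hμ : μ ≠ 0) (hρ : ρ ≠ 0) :
    HasPi α r (μ • a) (ρ • b) ((μ * ρ) • c) p := by
  unfold HasPi at hp ⊢
  have e : (μ * ρ) • c - (1 / 2 : ℝ) • coordProd (μ • a) (ρ • b)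
      = (μ * ρ) • (c - (1 / 2 : ℝ) • coordProd a b) := by
    ext i; simp [coordProd]; ring
  rw [matN_smul α h hμ hρ, e, Matrix.mulVec_smul, wedge_smul, mul_div_assoc, mul_div_assoc,
    mul_smul _ _ (vecReal p), ← hp, smul_sub, mul_smul _ (wedge b a / 2)]

/-- Translating by `k` changes `(I - N) c` by `(kb) a - (ka) b = (b ∧ a) (-k₂, k₁)`. -/
theorem HasPi.transl {α : ℝ} (h0 : α ≠ 0) (h1 : α ≠ 1) {r : ℕ} (hr : r ≠ 0) {a b c : Fin 2 → ℝ}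
    {p : Fin 2 → ℤ} (h : wedge b a ≠ 0) (hp : HasPi α r a b c p) (k : Fin 2 → ℤ) :
    HasPi α r a b (c - (α * rowMul k a / (α - 1)) • b - (rowMul k b / (α - 1)) • a)
      (p + (r : ℤ) • ![-k 1, k 0]) := by
  unfold HasPi at hp ⊢
  have h1' := sub_ne_zero.mpr h1
  have hr' : (r : ℝ) ≠ 0 := by exact_mod_cast hr
  have e : (1 - matN α a b).mulVec
      (c - (α * rowMul k a / (α - 1)) • b - (rowMul k b / (α - 1)) • a
        - (1 / 2 : ℝ) • coordProd a b)
      = (1 - matN α a b).mulVec (c - (1 / 2 : ℝ) • coordProd a b)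
        - rowMul k a • b + rowMul k b • a := by
    have : c - (α * rowMul k a / (α - 1)) • b - (rowMul k b / (α - 1)) • a
        - (1 / 2 : ℝ) • coordProd a b
        = (c - (1 / 2 : ℝ) • coordProd a b)
          - (α * rowMul k a / (α - 1)) • b - (rowMul k b / (α - 1)) • a := by abel
    rw [this, Matrix.mulVec_sub, Matrix.mulVec_sub, Matrix.mulVec_smul, Matrix.mulVec_smul,
      Matrix.sub_mulVec 1 _ b, Matrix.sub_mulVec 1 _ a, matN_mulVec_fst α h, matN_mulVec_snd α h,
      Matrix.one_mulVec, Matrix.one_mulVec]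
    ext i
    simp only [Pi.add_apply, Pi.sub_apply, Pi.smul_apply, smul_eq_mul]
    field_simp
    ring
  rw [e]
  have e2 : (wedge b a / (r : ℝ)) • vecReal (p + (r : ℤ) • ![-k 1, k 0])
      = (wedge b a / (r : ℝ)) • vecReal p + wedge b a • vecReal ![-k 1, k 0] := by
    ext i
    simp only [vecReal, Pi.add_apply, Pi.smul_apply, smul_eq_mul]
    push_cast
    field_simp
  have e3 : wedge b a • vecReal ![-k 1, k 0] = rowMul k b • a - rowMul k a • b := by
    ext i
    fin_cases i <;> simp [rowMul, wedge, vecReal] <;> ring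
  rw [e2, ← hp, e3]
  abel

theorem rowProd_mul (M K : Matrix (Fin 2) (Fin 2) ℤ) :
    ∃ q : Fin 2 → ℤ, rowProd (toReal (M * K)) = (toReal M).mulVec (rowProd (toReal K))
      + (K.det : ℝ) • rowProd (toReal M) + (2 : ℝ) • vecReal q := by
  choose q hq using fun i => row_mul_parity (M i 0) (M i 1) (K 0 0) (K 0 1) (K 1 0) (K 1 1)
  refine ⟨q, ?_⟩
  ext i
  have hq' : (_ : ℝ) = _ := congrArg (fun z : ℤ => (z : ℝ)) (hq i)
  push_cast at hq'
  simp only [rowProd_toReal, Pi.add_apply, Pi.smul_apply, smul_eq_mul, toReal_mulVec_apply,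
    Matrix.mul_apply, Fin.sum_univ_two, Matrix.det_fin_two, vecReal]
  push_cast
  linear_combination hq'

theorem toReal_one_sub (M : Matrix (Fin 2) (Fin 2) ℤ) : toReal (1 - M) = 1 - toReal M := by
  rw [← toReal_one]
  ext i j
  simp only [toReal, Matrix.sub_apply, Matrix.map_apply, Int.cast_sub]

theorem toReal_mulVec_vecReal (M : Matrix (Fin 2) (Fin 2) ℤ) (v : Fin 2 → ℤ) :
    (toReal M).mulVec (vecReal v) = vecReal (M.mulVec v) := by
  ext i
  rw [toReal_mulVec_apply]
  simp only [vecReal, Matrix.mulVec, dotProduct, Fin.sum_univ_two]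
  push_cast
  ring

/-- The vector `q` comes from computing the row products of `K N = (K N K⁻¹) K` in two ways. -/
theorem HasPi.mat {α : ℝ} (h0 : α ≠ 0) {r : ℕ} (hr : r ≠ 0) {a b : Fin 2 → ℝ}
    {M M' : Matrix (Fin 2) (Fin 2) ℤ} (K : GL (Fin 2) ℤ) (h : CompatiblePair α a b)
    (hM : matN α a b = toReal M)
    (hM' : matN α ((toReal K.val).mulVec a) ((toReal K.val).mulVec b) = toReal M')
    (hK : M' * K.val = K.val * M) :
    ∃ q : Fin 2 → ℤ, ∀ c p, HasPi α r a b c p →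
      HasPi α r ((toReal K.val).mulVec a) ((toReal K.val).mulVec b)
        ((1 / 2 : ℝ) • coordProd ((toReal K.val).mulVec a) ((toReal K.val).mulVec b)
          + (toReal K.val).mulVec (c - (1 / 2 : ℝ) • coordProd a b)
          + (wedge b a / 2) • rowProd (toReal K.val))
        (K.val.det • K.val.mulVec p + (r : ℤ) • q) := by
  obtain ⟨q₁, h₁⟩ := rowProd_mul K.val M
  obtain ⟨q₂, h₂⟩ := rowProd_mul M' K.val
  have hr' : (r : ℝ) ≠ 0 := by exact_mod_cast hr
  have hdet : M.det = 1 := (matN_mem h0 h hM).1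
  rw [hK] at h₂
  rw [h₁, hdet] at h₂
  refine ⟨K.val.det • (q₂ - q₁), fun c p hp => ?_⟩
  unfold HasPi at hp ⊢
  rw [hM] at hp
  rw [hM']
  set v := c - (1 / 2 : ℝ) • coordProd a b with hv
  have e1 : (1 - toReal M').mulVec ((toReal K.val).mulVec v)
      = (toReal K.val).mulVec ((1 - toReal M).mulVec v) := by
    rw [Matrix.mulVec_mulVec, Matrix.mulVec_mulVec, Matrix.sub_mul, Matrix.mul_sub, ← toReal_mul,
      ← toReal_mul, hK, Matrix.one_mul, Matrix.mul_one]
  have e2 : (1 - toReal M).mulVec v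
      = (wedge b a / (r : ℝ)) • vecReal p + (wedge b a / 2) • rowProd (toReal M) := by
    rw [← hp]; abel
  have e3 : ∀ x y z : Fin 2 → ℝ, x + y + z - x = y + z := fun x y z => by abel
  have hd := GL_det_sq K
  rw [e3, Matrix.mulVec_add, e1, e2, Matrix.mulVec_add, Matrix.mulVec_smul, Matrix.mulVec_smul,
    Matrix.mulVec_smul, toReal_mulVec_vecReal, Matrix.sub_mulVec, Matrix.one_mulVec, wedge_mulVec]
  generalize K.val.det = d at hd h₂
  have hd' : (d : ℝ) * d = 1 := by exact_mod_cast hd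
  ext i
  have h3 := congrFun h₂ i
  simp only [Pi.add_apply, Pi.sub_apply, Pi.smul_apply, smul_eq_mul, vecReal] at h3 ⊢
  push_cast at h3 ⊢
  field_simp
  linear_combination (wedge b a * r) * h3
    - (2 * wedge b a * (K.val.mulVec p i + r * (q₂ i - q₁ i))) * hd'

/-- The invariant of `g · c` is `(det K) K (p + r (-k₂, k₁))` up to a vector of `r ℤ²` that depends
on `(a,b)` and `K` only. -/
theorem HasPi.act {α : ℝ} (h0 : α ≠ 0) (h1 : α ≠ 1) {r : ℕ} (hr : r ≠ 0) {a b : Fin 2 → ℝ}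
    (h : CompatiblePair α a b) (μ ρ : ℝ) (hμ : 0 < μ) (hρ : ρ ≠ 0) (K : GL (Fin 2) ℤ) :
    ∃ q : Fin 2 → ℤ, ∀ (k : Fin 2 → ℤ) (c : Fin 2 → ℝ) (t : ℂ) (p : Fin 2 → ℤ),
      HasPi α r a b c p →
      HasPi α r (InoueII.act α ⟨μ, ρ, K, k, hμ, hρ⟩ (a, b, c, t)).1
        (InoueII.act α ⟨μ, ρ, K, k, hμ, hρ⟩ (a, b, c, t)).2.1
        (InoueII.act α ⟨μ, ρ, K, k, hμ, hρ⟩ (a, b, c, t)).2.2.1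
        (K.val.det • K.val.mulVec (p + (r : ℤ) • ![-k 1, k 0]) + (r : ℤ) • q) := by
  obtain ⟨M, hM⟩ := h.2
  have hw := wedge_ne_zero h.1
  have hw' : wedge (ρ • b) (μ • a) ≠ 0 := by
    rw [wedge_smul]; exact mul_ne_zero (mul_ne_zero hμ.ne' hρ) hw
  have h' : CompatiblePair α (μ • a) (ρ • b) :=
    ⟨linearIndependent_of_wedge_ne_zero hw', M, by rw [matN_smul α hw hμ.ne' hρ, hM]⟩
  have hM' : matN α ((toReal K.val).mulVec (μ • a)) ((toReal K.val).mulVec (ρ • b))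
      = toReal (K.val * M * K⁻¹.val) := by
    have := matN_orbit h ⟨μ, ρ, K, 0, hμ, hρ⟩
    rw [Matrix.mulVec_smul, Matrix.mulVec_smul]
    rw [this, hM, toReal_mul, toReal_mul]
  obtain ⟨q, hq⟩ := HasPi.mat h0 hr K h' (by rw [matN_smul α hw hμ.ne' hρ, hM]) hM'
    (by rw [Matrix.mul_assoc, ← Units.val_mul]; simp)
  exact ⟨q, fun k c t p hp => hq _ _ ((hp.scale hw hμ.ne' hρ).transl h0 h1 hr hw' k)⟩

theorem act_mem {α : ℝ} (h0 : α ≠ 0) (h1 : α ≠ 1) {r : ℕ} (hr : r ≠ 0) (g : GroupElt) {x : Quad}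
    (h : CompatiblePair α x.1 x.2.1 ∧ CompatibleVec α r x.1 x.2.1 x.2.2.1) :
    CompatiblePair α (act α g x).1 (act α g x).2.1 ∧
      CompatibleVec α r (act α g x).1 (act α g x).2.1 (act α g x).2.2.1 := by
  obtain ⟨a, b, c, t⟩ := x
  obtain ⟨μ, ρ, K, k, hμ, hρ⟩ := g
  constructor
  · have := h.1.orbit ⟨μ, ρ, K, k, hμ, hρ⟩
    simpa [act, scaleAct, transAct, matAct, Matrix.mulVec_smul] using this
  · obtain ⟨q, hq⟩ := HasPi.act h0 h1 hr h.1 μ ρ hμ hρ K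
    obtain ⟨p, hp⟩ := h.2
    exact ⟨_, hq k c t p hp⟩

/-- The class of `c` modulo `((b ∧ a)/r) ℤ²` corresponds to the class of `π(c)` modulo
`(I - N) ℤ²`. -/
theorem HasPi.class_iff {α : ℝ} (h0 : α ≠ 0) (h1 : α ≠ 1) {r : ℕ} (hr : r ≠ 0)
    {a b c c' : Fin 2 → ℝ} {p p' : Fin 2 → ℤ} (h : wedge b a ≠ 0)
    {M : Matrix (Fin 2) (Fin 2) ℤ} (hM : matN α a b = toReal M)
    (hp : HasPi α r a b c p) (hp' : HasPi α r a b c' p') (s : Fin 2 → ℤ) :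
    c' = c + (wedge b a / (r : ℝ)) • vecReal s ↔ p' = p + (1 - M).mulVec s := by
  have hr' : (r : ℝ) ≠ 0 := by exact_mod_cast hr
  have hwr : wedge b a / (r : ℝ) ≠ 0 := div_ne_zero h hr'
  have hdet := det_one_sub_matN h0 h1 h
  unfold HasPi at hp hp'
  have e : (1 - matN α a b).mulVec (c' - c) = (wedge b a / (r : ℝ)) • vecReal (p' - p) := by
    have : vecReal (p' - p) = vecReal p' - vecReal p := by ext; simp [vecReal]
    rw [this, smul_sub, ← hp, ← hp', Matrix.mulVec_sub, Matrix.mulVec_sub, Matrix.mulVec_sub]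
    abel
  have e1 : ∀ s, (1 - matN α a b).mulVec ((wedge b a / (r : ℝ)) • vecReal s)
      = (wedge b a / (r : ℝ)) • vecReal ((1 - M).mulVec s) := by
    intro s
    rw [Matrix.mulVec_smul, hM, ← toReal_one_sub, toReal_mulVec_vecReal]
  have hinj : Function.Injective vecReal := by
    intro u v huv; ext i; have := congrFun huv i; simpa [vecReal] using this
  constructor
  · intro hc
    have hc' : c' - c = (wedge b a / (r : ℝ)) • vecReal s := by rw [hc]; abel
    rw [hc', e1] at e
    rw [hinj (smul_right_injective _ hwr e)]
    abel
  · intro hpp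
    have hpp' : p' - p = (1 - M).mulVec s := by rw [hpp]; abel
    rw [hpp', ← e1] at e
    have := Matrix.mulVec_injective_of_isUnit
      ((Matrix.isUnit_iff_isUnit_det _).mpr (isUnit_iff_ne_zero.mpr hdet)) e
    rw [← this]; abel

/-! ### The affine maps of `ℂ` induced by the stabiliser of `[c]` -/

/-- The translation of `t` that `k` produces on `(a,b,c,t)`. -/
noncomputable def shift (α : ℝ) (k : Fin 2 → ℤ) (a b c : Fin 2 → ℝ) : ℝ :=
  α * rowMul k a * rowMul k b / (1 - α) + rowMul k c
    + ((k 0 : ℝ) * ((k 0 : ℝ) - 1) * a 0 * b 0 + (k 1 : ℝ) * ((k 1 : ℝ) - 1) * a 1 * b 1) / 2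
    + (k 0 : ℝ) * (k 1 : ℝ) * b 0 * a 1

/-- Some element of the group with `μρ = ε` fixes `(a,b,[c])` and acts on `t` by
`t ↦ ε t + τ`, up to the lattice. -/
def Moves (α : ℝ) (r : ℕ) (a b c : Fin 2 → ℝ) (ε τ : ℝ) : Prop :=
  ∃ g : GroupElt, g.μ * g.ρ = ε ∧
    ∀ t : ℂ, SameClass r (act α g (a, b, c, t)) (a, b, c, (ε : ℂ) * t + (τ : ℂ))

/-- `SameClass` in terms of projections, for quadruples that are not given as explicit tuples. -/
theorem sameClass_iff {r : ℕ} {x y : Quad} : SameClass r x y ↔ y.1 = x.1 ∧ y.2.1 = x.2.1 ∧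
    (∃ s : Fin 2 → ℤ, y.2.2.1 = x.2.2.1 + (wedge x.2.1 x.1 / (r : ℝ)) • vecReal s) ∧
    ∃ s₀ : ℤ, y.2.2.2 = x.2.2.2 + ((wedge x.2.1 x.1 / (r : ℝ) * (s₀ : ℝ) : ℝ) : ℂ) := Iff.rfl

/-- A group element acts on `t` by an affine map with linear part `μρ`. -/
theorem sameClass_affine {α : ℝ} {r : ℕ} {a b c a' b' c' : Fin 2 → ℝ} {g : GroupElt} {t t' : ℂ}
    (h : SameClass r (act α g (a, b, c, t)) (a', b', c', t')) :
    ∃ τ : ℝ, (∀ t₁ : ℂ, SameClass r (act α g (a, b, c, t₁))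
      (a', b', c', ((g.μ * g.ρ : ℝ) : ℂ) * t₁ + (τ : ℂ))) ∧
        t' = ((g.μ * g.ρ : ℝ) : ℂ) * t + (τ : ℂ) := by
  obtain ⟨h1, h2, h3, ⟨n, hn⟩⟩ := h
  refine ⟨shift α g.k (g.μ • a) (g.ρ • b) ((g.μ * g.ρ) • c)
    + wedge (act α g (a, b, c, t)).2.1 (act α g (a, b, c, t)).1 / r * n,
    fun t₁ => ⟨h1, h2, h3, ⟨n, ?_⟩⟩, ?_⟩
  · rw [Complex.ofReal_add, ← add_assoc]; rfl
  · rw [Complex.ofReal_add, ← add_assoc]; exact hn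

theorem moves_of_sameClass {α : ℝ} {r : ℕ} {a b c : Fin 2 → ℝ} {g : GroupElt} {t t' : ℂ}
    (h : SameClass r (act α g (a, b, c, t)) (a, b, c, t')) :
    ∃ τ, Moves α r a b c (g.μ * g.ρ) τ ∧ t' = ((g.μ * g.ρ : ℝ) : ℂ) * t + (τ : ℂ) :=
  let ⟨τ, h1, h2⟩ := sameClass_affine h
  ⟨τ, ⟨g, rfl, h1⟩, h2⟩

theorem Moves.sameClass {α : ℝ} {r : ℕ} {a b c : Fin 2 → ℝ} {ε τ : ℝ}
    (h : Moves α r a b c ε τ) (t : ℂ) :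
    ∃ g, SameClass r (act α g (a, b, c, t)) (a, b, c, (ε : ℂ) * t + (τ : ℂ)) :=
  let ⟨g, _, hg⟩ := h
  ⟨g, hg t⟩

theorem mem_pairStab_iff {α : ℝ} {a b c : Fin 2 → ℝ} {t : ℂ} {g : GroupElt} :
    g ∈ pairStab a b ↔ a = (act α g (a, b, c, t)).1 ∧ b = (act α g (a, b, c, t)).2.1 := by
  simp only [pairStab, Set.mem_ofPred_eq, act, scaleAct, transAct, matAct, Matrix.mulVec_smul]
  exact ⟨fun h => ⟨h.1.symm, h.2.symm⟩, fun h => ⟨h.1.symm, h.2.symm⟩⟩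

theorem sameClass_of_mem_pairStab {α : ℝ} {r : ℕ} {a b c c' : Fin 2 → ℝ} {g : GroupElt}
    (hg : g ∈ pairStab a b) (h : MovesClass α r a b g c c') (t : ℂ) :
    SameClass r (act α g (a, b, c, t)) (a, b, c', (act α g (a, b, c, t)).2.2.2) := by
  obtain ⟨h1, h2⟩ := (mem_pairStab_iff (α := α) (c := c) (t := t)).mp hg
  obtain ⟨s, hs⟩ := h
  refine sameClass_iff.mpr ⟨h1, h2, ⟨s, ?_⟩, ⟨0, ?_⟩⟩
  · rw [← h1, ← h2]
    exact hs
  · rw [Int.cast_zero, mul_zero, Complex.ofReal_zero, add_zero]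

theorem mem_pairStab_of_sameClass {α : ℝ} {r : ℕ} {a b c c' : Fin 2 → ℝ} {g : GroupElt} {t t' : ℂ}
    (h : SameClass r (act α g (a, b, c, t)) (a, b, c', t')) :
    g ∈ pairStab a b ∧ MovesClass α r a b g c c' := by
  obtain ⟨h1, h2, ⟨s, hs⟩, -⟩ := sameClass_iff.mp h
  refine ⟨mem_pairStab_iff.mpr ⟨h1, h2⟩, s, ?_⟩
  rw [← h1, ← h2] at hs
  exact hs

theorem moves_of_mem_pairStab {α : ℝ} {r : ℕ} {a b c : Fin 2 → ℝ} {g : GroupElt}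
    (hg : g ∈ pairStab a b) (h : MovesClass α r a b g c c) :
    Moves α r a b c (g.μ * g.ρ) (shift α g.k (g.μ • a) (g.ρ • b) ((g.μ * g.ρ) • c)) :=
  ⟨g, rfl, fun t => sameClass_of_mem_pairStab hg h t⟩

theorem mul_det_eq_one {a b : Fin 2 → ℝ} (h : wedge b a ≠ 0) {g : GroupElt}
    (hg : g ∈ pairStab a b) : g.μ * g.ρ * (g.K.val.det : ℝ) = 1 := by
  have : wedge (g.ρ • (toReal g.K.val).mulVec b) (g.μ • (toReal g.K.val).mulVec a) = wedge b a := by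
    rw [hg.1, hg.2]
  rw [wedge_smul, wedge_mulVec] at this
  exact mul_right_cancel₀ h (by linear_combination this)

/-- In the stabiliser of `(a,b)` the factor of `t` is `det K`, because `b ∧ a` is preserved. -/
theorem mul_eq_det {a b : Fin 2 → ℝ} (h : wedge b a ≠ 0) {g : GroupElt}
    (hg : g ∈ pairStab a b) : g.μ * g.ρ = (g.K.val.det : ℝ) := by
  have h1 := mul_det_eq_one h hg
  have h2 : (g.K.val.det : ℝ) * g.K.val.det = 1 := by exact_mod_cast GL_det_sq g.K
  linear_combination (g.K.val.det : ℝ) * h1 - g.μ * g.ρ * h2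

theorem Moves.sign {α : ℝ} {r : ℕ} {a b c : Fin 2 → ℝ} (h : wedge b a ≠ 0) {ε τ : ℝ}
    (hm : Moves α r a b c ε τ) : ε = 1 ∨ ε = -1 := by
  obtain ⟨g, hε, hg⟩ := hm
  rw [← hε, mul_eq_det h (mem_pairStab_of_sameClass (hg 0)).1]
  have h2 : (g.K.val.det : ℝ) * g.K.val.det = 1 := by exact_mod_cast GL_det_sq g.K
  exact mul_self_eq_one_iff.mp h2

theorem Moves.lattice (α : ℝ) {r : ℕ} (a b c : Fin 2 → ℝ) (n : ℤ) :
    Moves α r a b c 1 (wedge b a / r * n) := by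
  refine ⟨1, by simp, fun t => ?_⟩
  rw [act_one]
  exact ⟨rfl, rfl, ⟨0, by ext; simp [vecReal]⟩, ⟨n, by simp⟩⟩

theorem Moves.one (α : ℝ) {r : ℕ} (a b c : Fin 2 → ℝ) : Moves α r a b c 1 0 := by
  simpa using Moves.lattice α (r := r) a b c 0

theorem Moves.mul {α : ℝ} (hα : α ≠ 1) {r : ℕ} (hr : r ≠ 0) {a b c : Fin 2 → ℝ} {ε τ ε' τ' : ℝ}
    (h : Moves α r a b c ε τ) (h' : Moves α r a b c ε' τ') :
    Moves α r a b c (ε' * ε) (ε' * τ + τ') := by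
  obtain ⟨g, hε, hg⟩ := h
  obtain ⟨g', hε', hg'⟩ := h'
  refine ⟨g' * g, by rw [← hε, ← hε']; simp; ring, fun t => ?_⟩
  have := (hg t).act_trans hα hr (hg' _)
  convert this using 4
  push_cast; ring

theorem Moves.inv {α : ℝ} (hα : α ≠ 1) {r : ℕ} (hr : r ≠ 0) {a b c : Fin 2 → ℝ}
    (hw : wedge b a ≠ 0) {ε τ : ℝ} (h : Moves α r a b c ε τ) : Moves α r a b c ε (-(ε * τ)) := by
  have hε := h.sign hw
  obtain ⟨g, hg1, hg⟩ := h
  have hεε : ε * ε = 1 := by rcases hε with h | h <;> simp [h]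
  refine ⟨g⁻¹, ?_, fun t => ?_⟩
  · rw [GroupElt.inv_μ, GroupElt.inv_ρ, ← mul_inv, hg1]
    exact inv_eq_of_mul_eq_one_left hεε
  · have h1 := (hg (ε * t - ε * τ)).act_symm hα hr
    have hεε' : (ε : ℂ) * ε = 1 := by exact_mod_cast hεε
    have e : (ε : ℂ) * (ε * t - ε * τ) + τ = t := by linear_combination (t - τ) * hεε'
    rw [e] at h1
    convert h1 using 4
    push_cast; ring

/-- The translations form a subgroup of `ℝ`. -/
def translations {α : ℝ} (hα : α ≠ 1) {r : ℕ} (hr : r ≠ 0) {a b : Fin 2 → ℝ} (c : Fin 2 → ℝ)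
    (hw : wedge b a ≠ 0) : AddSubgroup ℝ where
  carrier := {τ | Moves α r a b c 1 τ}
  zero_mem' := Moves.one α a b c
  add_mem' := fun h h' => by simpa using Moves.mul hα hr h h'
  neg_mem' := fun h => by simpa using Moves.inv hα hr hw h

/-- The translation lengths are rational multiples of `b ∧ a` with a common denominator: the term
quadratic in `k` is `(ka)(kb)(1 + α)/(2(1 - α))`, where `(ka)(kb)(α - α⁻¹)` is an integral multiple
of `b ∧ a`, and `(α - α⁻¹)(1 - α)/(1 + α) = 2 - (α + α⁻¹)` is an integer. -/
theorem shift_denominator {α : ℝ} (hα : SPlusAdmissible α) {r : ℕ} (hr : r ≠ 0) :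
    ∃ D : ℤ, D ≠ 0 ∧ ∀ (a b c : Fin 2 → ℝ) (p : Fin 2 → ℤ), CompatiblePair α a b →
      HasPi α r a b c p → ∀ k, ∃ n : ℤ, D * shift α k a b c = wedge b a * n := by
  obtain ⟨θ, hθ, hθα, h1⟩ := hα.exists_trace
  refine ⟨2 * r * (θ - 2), ?_, ?_⟩
  · have : (r : ℤ) ≠ 0 := by exact_mod_cast hr
    exact mul_ne_zero (mul_ne_zero two_ne_zero this) (by omega)
  intro a b c p h hp k
  obtain ⟨M, hM⟩ := h.2
  have hw := wedge_ne_zero h.1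
  have h0 : α ≠ 0 := by positivity
  have hr' : (r : ℝ) ≠ 0 := by exact_mod_cast hr
  have h1' : α - 1 ≠ 0 := sub_ne_zero.mpr h1.ne'
  have h1'' : 1 - α ≠ 0 := by intro h; apply h1'; linarith
  -- the entries of the integral matrix, cleared of denominators
  have ent : ∀ i j, wedge b a * α * (M i j : ℝ) = wedge b a * α * matN α a b i j := by
    intro i j; rw [hM]; rfl
  rw [matN_apply α hw] at ent
  have e00 := ent 0 0
  have e01 := ent 0 1
  have e10 := ent 1 0
  have e11 := ent 1 1
  simp only [Matrix.of_apply, Matrix.cons_val', Matrix.cons_val_zero, Matrix.cons_val_one,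
    Matrix.empty_val', Matrix.cons_val_fin_one] at e00 e01 e10 e11
  field_simp at e00 e01 e10 e11
  -- the equation for `c`, coordinate by coordinate
  unfold HasPi at hp
  rw [hM] at hp
  have p0 := congrFun hp 0
  have p1 := congrFun hp 1
  rw [Matrix.sub_mulVec, Matrix.one_mulVec] at p0 p1
  simp only [Pi.sub_apply, Pi.smul_apply, smul_eq_mul, toReal_mulVec_apply, rowProd_toReal,
    vecReal, coordProd] at p0 p1
  -- `(α² - 1) (ka)(kb) = (b ∧ a) α m` with an integer `m`
  set m : ℤ := k 0 * k 0 * M 0 1 - k 1 * k 1 * M 1 0 + k 0 * k 1 * (M 1 1 - M 0 0) with hm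
  have hX : (α * α - 1) * (rowMul k a * rowMul k b) = wedge b a * α * m := by
    rw [hm]; push_cast; unfold rowMul
    linear_combination (-k 0 * k 0 : ℝ) * e01 + (k 1 * k 1 : ℝ) * e10
      - (k 0 * k 1 : ℝ) * (e11 - e00)
  have htr : ((M 0 0 + M 1 1 : ℤ) : ℝ) = θ := by
    have : wedge b a * α * ((M 0 0 + M 1 1 : ℤ) : ℝ) = wedge b a * α * θ := by
      push_cast
      have hwd : wedge b a = b 0 * a 1 - b 1 * a 0 := rfl
      linear_combination e00 + e11 + (wedge b a) * hθα - (α * α + 1) * hwd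
    exact mul_left_cancel₀ (mul_ne_zero hw h0) this
  have hdet : ((M 0 0 * M 1 1 - M 0 1 * M 1 0 : ℤ) : ℝ) = 1 := by
    have := (matN_mem h0 h hM).1
    rw [Matrix.det_fin_two] at this
    exact_mod_cast this
  push_cast at htr hdet
  set R : Fin 2 → ℤ := fun i => r * (M i 0 * M i 1) + 2 * p i with hR
  set u := c 0 - 1 / 2 * (a 0 * b 0) with hu
  set v := c 1 - 1 / 2 * (a 1 * b 1) with hv
  have q0 : 2 * r * (u - (M 0 0 * u + M 0 1 * v)) = wedge b a * R 0 := by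
    rw [hR]; push_cast
    field_simp at p0
    linear_combination p0
  have q1 : 2 * r * (v - (M 1 0 * u + M 1 1 * v)) = wedge b a * R 1 := by
    rw [hR]; push_cast
    field_simp at p1
    linear_combination p1
  have hq : 2 * r * (θ - 2) * (k 0 * u + k 1 * v) = -(wedge b a * (k 0 * ((1 - M 1 1) * R 0
      + M 0 1 * R 1) + k 1 * (M 1 0 * R 0 + (1 - M 0 0) * R 1))) := by
    linear_combination (-(k 0 * (1 - M 1 1) + k 1 * M 1 0) : ℝ) * q0
      - (k 0 * M 0 1 + k 1 * (1 - M 0 0) : ℝ) * q1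
      + 2 * r * (k 0 * u + k 1 * v) * (hdet - htr)
  have hs : 2 * (1 - α) * shift α k a b c = (1 + α) * (rowMul k a * rowMul k b)
      + 2 * (1 - α) * (k 0 * u + k 1 * v) + (1 - α) * (k 0 * k 1 * wedge b a) := by
    rw [hu, hv]
    unfold shift
    field_simp
    unfold rowMul wedge
    ring
  refine ⟨-r * m - (k 0 * ((1 - M 1 1) * R 0 + M 0 1 * R 1) + k 1 * (M 1 0 * R 0
    + (1 - M 0 0) * R 1)) + r * (θ - 2) * (k 0 * k 1), ?_⟩
  push_cast
  refine mul_left_cancel₀ (mul_ne_zero h0 h1'') ?_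
  linear_combination (r * (θ - 2) * α) * hs + (1 - α) * α * hq - r * (1 - α) * hX
    - r * (1 + α) * (rowMul k a * rowMul k b) * hθα

/-- A common denominator of the lengths `τ`, also for the maps with `ε = -1`. -/
theorem Moves.denominator {α : ℝ} (hα : SPlusAdmissible α) {r : ℕ} (hr : r ≠ 0)
    {a b c : Fin 2 → ℝ} {p : Fin 2 → ℤ} (h : CompatiblePair α a b) (hp : HasPi α r a b c p) :
    ∃ D : ℤ, D ≠ 0 ∧ ∀ ε τ, Moves α r a b c ε τ → ∃ n : ℤ, D * τ = wedge b a * n := by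
  obtain ⟨D, hD, hD'⟩ := shift_denominator hα hr
  have hr' : (r : ℝ) ≠ 0 := by exact_mod_cast hr
  have hw := wedge_ne_zero h.1
  refine ⟨r * D, mul_ne_zero (by exact_mod_cast hr) hD, fun ε τ hm => ?_⟩
  have hε := hm.sign hw
  obtain ⟨g, hg1, hg⟩ := hm
  have hstab := (mem_pairStab_of_sameClass (hg 0)).1
  obtain ⟨h1, h2, -, ⟨s, hs⟩⟩ := sameClass_iff.mp (hg 0)
  dsimp only at h1 h2
  have hμρ : g.μ * g.ρ ≠ 0 := mul_ne_zero g.μ_pos.ne' g.ρ_ne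
  have h' : CompatiblePair α (g.μ • a) (g.ρ • b) := by
    obtain ⟨M, hM⟩ := h.2
    refine ⟨linearIndependent_of_wedge_ne_zero ?_, M, ?_⟩
    · rw [wedge_smul]; exact mul_ne_zero hμρ hw
    · rw [matN_smul α hw g.μ_pos.ne' g.ρ_ne, hM]
  obtain ⟨n, hn⟩ := hD' _ _ _ p h' (hp.scale hw g.μ_pos.ne' g.ρ_ne) g.k
  rw [← h1, ← h2] at hs
  have hτ : τ = shift α g.k (g.μ • a) (g.ρ • b) ((g.μ * g.ρ) • c) + wedge b a / r * s := by
    have e : (act α g (a, b, c, 0)).2.2.2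
        = ((shift α g.k (g.μ • a) (g.ρ • b) ((g.μ * g.ρ) • c) : ℝ) : ℂ) := by
      have : (act α g (a, b, c, 0)).2.2.2 = ((g.μ * g.ρ : ℝ) : ℂ) * 0
        + ((shift α g.k (g.μ • a) (g.ρ • b) ((g.μ * g.ρ) • c) : ℝ) : ℂ) := rfl
      rw [this, mul_zero, zero_add]
    rw [e] at hs
    simp only [mul_zero, zero_add] at hs
    exact_mod_cast hs
  rw [wedge_smul] at hn
  conv_rhs at hn => rw [hg1]
  rcases hε with rfl | rfl
  · refine ⟨r * n + D * s, ?_⟩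
    rw [hτ]; push_cast; field_simp
    linear_combination (r : ℝ) * hn
  · refine ⟨-r * n + D * s, ?_⟩
    rw [hτ]; push_cast; field_simp
    linear_combination (r : ℝ) * hn

/-- The translations form a nontrivial subgroup of the cyclic group generated by `(b ∧ a)/D`. -/
theorem exists_translations_eq {α : ℝ} (hα : SPlusAdmissible α) {r : ℕ} (hr : r ≠ 0)
    {a b c : Fin 2 → ℝ} {p : Fin 2 → ℤ} (h : CompatiblePair α a b) (hp : HasPi α r a b c p) :
    ∃ l : ℝ, l ≠ 0 ∧ ∀ τ, Moves α r a b c 1 τ ↔ ∃ n : ℤ, τ = l * n := by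
  have hw := wedge_ne_zero h.1
  have hr' : (r : ℝ) ≠ 0 := by exact_mod_cast hr
  obtain ⟨D, hD, hD'⟩ := Moves.denominator hα hr h hp
  have hD0 : (D : ℝ) ≠ 0 := by exact_mod_cast hD
  set T := translations hα.ne_one hr c hw
  obtain ⟨m, hm⟩ := Int.subgroup_cyclic (T.comap (zmultiplesHom ℝ (wedge b a / D)))
  have key : ∀ τ, Moves α r a b c 1 τ ↔ ∃ n : ℤ, τ = wedge b a / D * m * n := by
    intro τ
    constructor
    · intro hτ
      obtain ⟨n, hn⟩ := hD' _ _ hτ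
      have hτn : τ = n • (wedge b a / D) := by
        rw [zsmul_eq_mul]; field_simp; linear_combination hn
      have hmem : n ∈ T.comap (zmultiplesHom ℝ (wedge b a / D)) := by
        rw [AddSubgroup.mem_comap, zmultiplesHom_apply, ← hτn]; exact hτ
      rw [hm, AddSubgroup.mem_closure_singleton] at hmem
      obtain ⟨j, rfl⟩ := hmem
      refine ⟨j, ?_⟩
      rw [hτn]; simp; ring
    · rintro ⟨n, rfl⟩
      have hmem : n • m ∈ T.comap (zmultiplesHom ℝ (wedge b a / D)) := by
        rw [hm, AddSubgroup.mem_closure_singleton]; exact ⟨n, rfl⟩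
      rw [AddSubgroup.mem_comap, zmultiplesHom_apply] at hmem
      have e : wedge b a / D * m * n = (n • m) • (wedge b a / D) := by simp; ring
      rw [e]; exact hmem
  refine ⟨wedge b a / D * m, fun h0 => ?_, key⟩
  obtain ⟨n, hn⟩ := (key _).mp (Moves.lattice α a b c 1)
  rw [h0, zero_mul, Int.cast_one, mul_one] at hn
  exact div_ne_zero hw hr' hn

/-! ### Condition (C) and orientation-reversing symmetries -/

theorem eq_wedge_smul_add {a b : Fin 2 → ℝ} (h : wedge b a ≠ 0) (v : Fin 2 → ℝ) :
    v = (wedge b v / wedge b a) • a + (wedge v a / wedge b a) • b := by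
  ext i
  fin_cases i <;> simp <;> field_simp <;> unfold wedge <;> ring

theorem wedge_matN_mulVec {α : ℝ} {a b : Fin 2 → ℝ} (h : wedge b a ≠ 0) (v : Fin 2 → ℝ) :
    wedge b ((matN α a b).mulVec v) = α * wedge b v ∧
      wedge ((matN α a b).mulVec v) a = α⁻¹ * wedge v a := by
  have e := congrArg (matN α a b).mulVec (eq_wedge_smul_add h v)
  rw [Matrix.mulVec_add, Matrix.mulVec_smul, Matrix.mulVec_smul, matN_mulVec_fst α h,
    matN_mulVec_snd α h] at e
  rw [e]
  generalize α⁻¹ = β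
  constructor
  · have : ∀ x y : ℝ, wedge b (x • α • a + y • β • b) = x * α * wedge b a := by
      intro x y; simp [wedge]; ring
    rw [this]; field_simp
  · have : ∀ x y : ℝ, wedge (x • α • a + y • β • b) a = y * β * wedge b a := by
      intro x y; simp [wedge]; ring
    rw [this]; field_simp

theorem sub_inv_ne_zero_of_one_lt {α : ℝ} (h : 1 < α) : α - α⁻¹ ≠ 0 := by
  have : α⁻¹ < 1 := inv_lt_one_of_one_lt₀ h
  linarith

theorem eq_smul_fst {α : ℝ} (hα : 1 < α) {a b : Fin 2 → ℝ} (h : wedge b a ≠ 0) {v : Fin 2 → ℝ}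
    (hv : (matN α a b).mulVec v = α • v) : v = (wedge b v / wedge b a) • a := by
  have h2 := (wedge_matN_mulVec (α := α) h v).2
  rw [hv] at h2
  have h3 : (α - α⁻¹) * wedge v a = 0 := by
    have : wedge (α • v) a = α * wedge v a := by simp [wedge]; ring
    linear_combination h2 - this
  have h4 := (mul_eq_zero.mp h3).resolve_left (sub_inv_ne_zero_of_one_lt hα)
  have h5 := eq_wedge_smul_add h v
  rw [h4, zero_div, zero_smul, add_zero] at h5
  exact h5

theorem eq_smul_snd {α : ℝ} (hα : 1 < α) {a b : Fin 2 → ℝ} (h : wedge b a ≠ 0) {v : Fin 2 → ℝ}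
    (hv : (matN α a b).mulVec v = α⁻¹ • v) : v = (wedge v a / wedge b a) • b := by
  have h2 := (wedge_matN_mulVec (α := α) h v).1
  rw [hv] at h2
  have h3 : (α - α⁻¹) * wedge b v = 0 := by
    have : wedge b (α⁻¹ • v) = α⁻¹ * wedge b v := by simp [wedge]; ring
    linear_combination this - h2
  have h4 := (mul_eq_zero.mp h3).resolve_left (sub_inv_ne_zero_of_one_lt hα)
  have h5 := eq_wedge_smul_add h v
  rw [h4, zero_div, zero_smul, zero_add] at h5
  exact h5

/-- Condition (C) says that some element of the stabiliser of `(a,b,[c])` reverses `t`. -/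
theorem conditionC_iff_moves {α : ℝ} (hα : SPlusAdmissible α) {r : ℕ} (hr : r ≠ 0)
    {a b c : Fin 2 → ℝ} {p : Fin 2 → ℤ} (h : CompatiblePair α a b) (hp : HasPi α r a b c p)
    {M : Matrix (Fin 2) (Fin 2) ℤ} (hM : matN α a b = toReal M) :
    ConditionC M r a p ↔ ∃ τ, Moves α r a b c (-1) τ := by
  have hw := wedge_ne_zero h.1
  have h0 := hα.ne_zero
  have h1 := hα.ne_one
  constructor
  · rintro ⟨K, ⟨hcomm, ϑ, hϑ, ha⟩, hdet, u, v, huv⟩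
    have hb : (toReal K.val).mulVec b
        = (wedge ((toReal K.val).mulVec b) a / wedge b a) • b := by
      apply eq_smul_snd hα.one_lt hw
      rw [hM, Matrix.mulVec_mulVec, ← toReal_mul, ← hcomm, toReal_mul, ← Matrix.mulVec_mulVec,
        ← hM, matN_mulVec_snd α hw, Matrix.mulVec_smul]
    set ϑ' := wedge ((toReal K.val).mulVec b) a / wedge b a with hϑ'
    have hprod : ϑ * ϑ' = -1 := by
      have := wedge_mulVec K.val a b
      rw [ha, hb, wedge_smul, hdet] at this
      push_cast at this
      exact mul_right_cancel₀ hw this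
    have hϑ0 : ϑ' ≠ 0 := by rintro h; rw [h] at hprod; norm_num at hprod
    obtain ⟨q, hq⟩ := HasPi.act h0 h1 hr h ϑ⁻¹ ϑ'⁻¹ (inv_pos.mpr hϑ) (inv_ne_zero hϑ0) K
    -- `(-k₂, k₁) = j` is chosen so that `π(g · c) = p - (I - N) v`
    set j := K⁻¹.val.mulVec (q - u) with hj
    have hKj : K.val.mulVec j = q - u := by
      rw [hj, Matrix.mulVec_mulVec, ← Units.val_mul]; simp
    set g : GroupElt := ⟨ϑ⁻¹, ϑ'⁻¹, K, ![j 1, -j 0], inv_pos.mpr hϑ, inv_ne_zero hϑ0⟩ with hg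
    have hstab : g ∈ pairStab a b := by
      constructor
      · change ϑ⁻¹ • (toReal K.val).mulVec a = a
        rw [ha, smul_smul, inv_mul_cancel₀ hϑ.ne', one_smul]
      · change ϑ'⁻¹ • (toReal K.val).mulVec b = b
        rw [hb, smul_smul, inv_mul_cancel₀ hϑ0, one_smul]
    obtain ⟨e1, e2⟩ := (mem_pairStab_iff (α := α) (c := c) (t := 0)).mp hstab
    have hp' := hq ![j 1, -j 0] c 0 p hp
    rw [← hg, ← e1, ← e2] at hp'
    have hjj : ![-(![j 1, -j 0] : Fin 2 → ℤ) 1, (![j 1, -j 0] : Fin 2 → ℤ) 0] = j := by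
      ext i; fin_cases i <;> simp
    rw [hjj] at hp'
    have hs := (HasPi.class_iff h0 h1 hr hw hM hp hp' (-v)).mpr (by
      rw [Matrix.mulVec_add, Matrix.mulVec_smul, hKj, hdet, Matrix.mulVec_neg]
      rw [Matrix.add_mulVec, Matrix.one_mulVec] at huv
      ext i
      have := congrFun huv i
      simp only [Pi.add_apply, Pi.smul_apply, Pi.sub_apply, Pi.neg_apply, smul_eq_mul] at this ⊢
      linear_combination -this)
    have hmv : MovesClass α r a b g c c := by
      refine ⟨v, ?_⟩
      rw [hs]
      have : vecReal (-v) = - vecReal v := by ext; simp [vecReal]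
      rw [this, smul_neg]; abel
    have hε : g.μ * g.ρ = -1 := by
      rw [mul_eq_det hw hstab]
      exact_mod_cast hdet
    exact ⟨_, hε ▸ moves_of_mem_pairStab hstab hmv⟩
  · rintro ⟨τ, g, hg1, hg⟩
    obtain ⟨hstab, s, hs⟩ := mem_pairStab_of_sameClass (hg 0)
    have hdet : g.K.val.det = -1 := by
      have := mul_eq_det hw hstab
      rw [hg1] at this
      exact_mod_cast this.symm
    refine ⟨g.K, ⟨?_, g.μ⁻¹, inv_pos.mpr g.μ_pos, ?_⟩, hdet, ?_⟩
    · have := matN_orbit h g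
      rw [hstab.1, hstab.2, hM, ← toReal_mul, ← toReal_mul] at this
      have := toReal_injective this
      conv_rhs => rw [this]
      rw [Matrix.mul_assoc, ← Units.val_mul]; simp
    · have := hstab.1
      conv_rhs => rw [← this]
      rw [smul_smul, inv_mul_cancel₀ g.μ_pos.ne', one_smul]
    · obtain ⟨q, hq⟩ := HasPi.act h0 h1 hr h g.μ g.ρ g.μ_pos g.ρ_ne g.K
      have hp' : HasPi α r (act α g (a, b, c, 0)).1 (act α g (a, b, c, 0)).2.1
        (act α g (a, b, c, 0)).2.2.1 _ := hq g.k c 0 p hp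
      obtain ⟨e1, e2⟩ := (mem_pairStab_iff (α := α) (c := c) (t := 0)).mp hstab
      rw [← e1, ← e2] at hp'
      have := (HasPi.class_iff h0 h1 hr hw hM hp' hp s).mp hs
      rw [Matrix.mulVec_add, Matrix.mulVec_smul, hdet] at this
      refine ⟨q - g.K.val.mulVec ![-g.k 1, g.k 0], s, ?_⟩
      rw [Matrix.add_mulVec, Matrix.one_mulVec]
      ext i
      have := congrFun this i
      simp only [Pi.add_apply, Pi.smul_apply, Pi.sub_apply, smul_eq_mul] at this ⊢
      linear_combination this

/-! ### The group of bijections of the cylinder -/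

theorem mem_stabImage_iff {α : ℝ} {r : ℕ} {a b c : Fin 2 → ℝ} {h : Equiv.Perm (Cyl r a b)} :
    h ∈ stabImage α r a b c ↔ ∃ ε τ, Moves α r a b c ε τ ∧
      ∀ t : ℂ, h (QuotientAddGroup.mk t) = QuotientAddGroup.mk ((ε : ℂ) * t + (τ : ℂ)) := by
  constructor
  · rintro ⟨g, hg, hm, ht⟩
    exact ⟨_, _, moves_of_mem_pairStab hg hm, ht⟩
  · rintro ⟨ε, τ, ⟨g, hg1, hg⟩, ht⟩
    obtain ⟨hstab, hm⟩ := mem_pairStab_of_sameClass (hg 0)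
    refine ⟨g, hstab, hm, fun t => ?_⟩
    obtain ⟨e1, e2⟩ := (mem_pairStab_iff (α := α) (c := c) (t := t)).mp hstab
    obtain ⟨-, -, -, ⟨s, hs⟩⟩ := sameClass_iff.mp (hg t)
    rw [← e1, ← e2] at hs
    rw [ht, QuotientAddGroup.eq]
    refine AddSubgroup.mem_zmultiples_iff.mpr ⟨-s, ?_⟩
    change (ε : ℂ) * t + (τ : ℂ) = _ at hs
    rw [hs]
    push_cast
    rw [zsmul_eq_mul]
    push_cast
    ring

/-- The image `H` of the stabiliser of `[c]`, as a group. -/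
def stabGroup {α : ℝ} (hα : α ≠ 1) {r : ℕ} (hr : r ≠ 0) {a b : Fin 2 → ℝ} (c : Fin 2 → ℝ)
    (hw : wedge b a ≠ 0) : Subgroup (Equiv.Perm (Cyl r a b)) where
  carrier := stabImage α r a b c
  one_mem' := mem_stabImage_iff.mpr ⟨1, 0, Moves.one α a b c, fun t => by simp⟩
  mul_mem' := by
    intro h h' hh hh'
    obtain ⟨ε, τ, hm, ht⟩ := mem_stabImage_iff.mp hh
    obtain ⟨ε', τ', hm', ht'⟩ := mem_stabImage_iff.mp hh'
    refine mem_stabImage_iff.mpr ⟨_, _, hm'.mul hα hr hm, fun t => ?_⟩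
    rw [Equiv.Perm.mul_apply, ht', ht]
    congr 1
    push_cast; ring
  inv_mem' := by
    intro h hh
    obtain ⟨ε, τ, hm, ht⟩ := mem_stabImage_iff.mp hh
    refine mem_stabImage_iff.mpr ⟨_, _, hm.inv hα hr hw, fun t => ?_⟩
    rw [Equiv.Perm.inv_eq_iff_eq, ht]
    congr 1
    have hεε : (ε : ℂ) * ε = 1 := by rcases hm.sign hw with h | h <;> simp [h]
    push_cast
    linear_combination (τ - t) * hεε

theorem mk_wedge_mul_int {r : ℕ} (hr : r ≠ 0) (a b : Fin 2 → ℝ) (n : ℤ) :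
    (QuotientAddGroup.mk (((wedge b a * n : ℝ) : ℂ)) : Cyl r a b) = 0 := by
  have hr' : (r : ℂ) ≠ 0 := by exact_mod_cast hr
  rw [QuotientAddGroup.eq_zero_iff]
  refine AddSubgroup.mem_zmultiples_iff.mpr ⟨n * r, ?_⟩
  rw [zsmul_eq_mul]
  push_cast
  field_simp

theorem stabImage_finite {α : ℝ} (hα : SPlusAdmissible α) {r : ℕ} (hr : r ≠ 0)
    {a b c : Fin 2 → ℝ} {p : Fin 2 → ℤ} (h : CompatiblePair α a b) (hp : HasPi α r a b c p) :
    (stabImage α r a b c).Finite := by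
  obtain ⟨D, hD, hD'⟩ := Moves.denominator hα hr h hp
  have hD0 : (D : ℝ) ≠ 0 := by exact_mod_cast hD
  let S : ℝ → ℤ → Set (Equiv.Perm (Cyl r a b)) := fun ε n =>
    {h | ∀ t : ℂ, h (QuotientAddGroup.mk t)
      = QuotientAddGroup.mk ((ε : ℂ) * t + ((wedge b a * n / D : ℝ) : ℂ))}
  have hS : ∀ ε n, (S ε n).Finite := by
    intro ε n
    refine Set.Subsingleton.finite fun h₁ m₁ h₂ m₂ => Equiv.ext fun x => ?_
    induction x using QuotientAddGroup.induction_on with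
    | H t => rw [m₁ t, m₂ t]
  refine Set.Finite.subset (Set.Finite.biUnion (Set.toFinite ({1, -1} : Set ℝ))
    fun ε _ => Set.Finite.biUnion (Set.finite_Ico (0 : ℤ) |D|) fun n _ => hS ε n) ?_
  intro g hg
  obtain ⟨ε, τ, hm, ht⟩ := mem_stabImage_iff.mp hg
  obtain ⟨n, hn⟩ := hD' _ _ hm
  simp only [Set.mem_iUnion]
  refine ⟨ε, by simpa using hm.sign (wedge_ne_zero h.1), n % D,
    ⟨Int.emod_nonneg _ hD, Int.emod_lt_abs _ hD⟩, fun t => ?_⟩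
  have hnD : (n : ℝ) = (n % D : ℤ) + D * (n / D : ℤ) := by
    exact_mod_cast (Int.emod_add_mul_ediv n D).symm
  -- `b ∧ a` is in the lattice `((b ∧ a)/r) ℤ`, so only `n` modulo `D` matters
  have hτ : τ = wedge b a * (n % D : ℤ) / D + wedge b a * (n / D : ℤ) := by
    field_simp
    linear_combination hn + wedge b a * hnD
  rw [ht, hτ, Complex.ofReal_add, ← add_assoc, QuotientAddGroup.mk_add, mk_wedge_mul_int hr,
    add_zero]

/-- The length of an element with `ε = -1` is a torsion element as well, by the common
denominator. -/
theorem stabGroup_le_torsionGroup {α : ℝ} (hα : SPlusAdmissible α) {r : ℕ} (hr : r ≠ 0)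
    {a b c : Fin 2 → ℝ} {p : Fin 2 → ℤ} (h : CompatiblePair α a b) (hp : HasPi α r a b c p) :
    stabGroup hα.ne_one hr c (wedge_ne_zero h.1) ≤ torsionGroup r a b := by
  obtain ⟨D, hD, hD'⟩ := Moves.denominator hα hr h hp
  intro g hg
  obtain ⟨ε, τ, hm, ht⟩ := mem_stabImage_iff.mp hg
  obtain ⟨n, hn⟩ := hD' _ _ hm
  have htor : Equiv.addRight (QuotientAddGroup.mk (τ : ℂ) : Cyl r a b) ∈ torsionGroup r a b := by
    refine Subgroup.subset_closure (Or.inl ⟨_, ?_, rfl⟩)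
    refine isOfFinAddOrder_iff_zsmul_eq_zero.mpr ⟨D, hD, ?_⟩
    rw [← QuotientAddGroup.mk_zsmul, zsmul_eq_mul]
    have : (D : ℂ) * τ = ((wedge b a * n : ℝ) : ℂ) := by rw [← hn]; push_cast; rfl
    rw [this, mk_wedge_mul_int hr]
  rcases hm.sign (wedge_ne_zero h.1) with rfl | rfl
  · convert htor
    ext x
    induction x using QuotientAddGroup.induction_on with
    | H t => rw [ht]; simp
  · convert (torsionGroup r a b).mul_mem htor
      (Subgroup.subset_closure (Or.inr (Set.mem_singleton (Equiv.neg _))))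
    ext x
    induction x using QuotientAddGroup.induction_on with
    | H t => rw [ht]; simp

theorem exists_swapsEnds_iff {α : ℝ} {r : ℕ} {a b c : Fin 2 → ℝ} (hw : wedge b a ≠ 0) :
    (∃ h ∈ stabImage α r a b c, SwapsEnds h) ↔ ∃ τ, Moves α r a b c (-1) τ := by
  constructor
  · rintro ⟨h, hh, σ, hσ⟩
    obtain ⟨ε, τ, hm, ht⟩ := mem_stabImage_iff.mp hh
    rcases hm.sign hw with rfl | rfl
    -- a translation is not of the form `x ↦ -x + σ`, because `i + i` is not in the real lattice
    · exfalso
      have e0 := (ht 0).symm.trans (hσ _)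
      have e1 := (ht Complex.I).symm.trans (hσ _)
      simp only [Complex.ofReal_one, one_mul, zero_add, QuotientAddGroup.mk_zero, neg_zero,
        QuotientAddGroup.mk_add] at e0 e1
      rw [← e0] at e1
      have e2 : (QuotientAddGroup.mk (Complex.I + Complex.I) : Cyl r a b) = 0 := by
        rw [QuotientAddGroup.mk_add]
        have := add_right_cancel e1
        nth_rewrite 2 [this]
        exact add_neg_cancel _
      rw [QuotientAddGroup.eq_zero_iff] at e2
      obtain ⟨n, hn⟩ := AddSubgroup.mem_zmultiples_iff.mp e2
      have := congrArg Complex.im hn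
      rw [zsmul_eq_mul, ← Complex.ofReal_intCast, ← Complex.ofReal_mul, Complex.ofReal_im] at this
      norm_num at this
    · exact ⟨τ, hm⟩
  · rintro ⟨τ, hm⟩
    let h : Equiv.Perm (Cyl r a b) :=
      Equiv.addRight (QuotientAddGroup.mk (τ : ℂ) : Cyl r a b) * Equiv.neg _
    have hh : ∀ x, h x = -x + QuotientAddGroup.mk (τ : ℂ) := fun x => rfl
    exact ⟨h, mem_stabImage_iff.mpr ⟨_, _, hm, fun t => by rw [hh]; simp⟩, _, hh⟩

/-! ### The topology of the moduli set -/

theorem continuous_scaleAct (μ ρ : ℝ) : Continuous (scaleAct μ ρ) := by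
  have e : scaleAct μ ρ = fun x : Quad =>
    (μ • x.1, ρ • x.2.1, (μ * ρ) • x.2.2.1, ((μ * ρ : ℝ) : ℂ) * x.2.2.2) := rfl
  rw [e]; fun_prop

theorem continuous_transAct (α : ℝ) (k : Fin 2 → ℤ) : Continuous (transAct α k) := by
  have e : transAct α k = fun x : Quad => (x.1, x.2.1,
      x.2.2.1 - (α * rowMul k x.1 / (α - 1)) • x.2.1 - (rowMul k x.2.1 / (α - 1)) • x.1,
      x.2.2.2 + ((shift α k x.1 x.2.1 x.2.2.1 : ℝ) : ℂ)) := rfl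
  rw [e]; unfold shift rowMul; fun_prop

theorem continuous_wedge {X : Type*} [TopologicalSpace X] {f g : X → Fin 2 → ℝ}
    (hf : Continuous f) (hg : Continuous g) : Continuous fun x => wedge (f x) (g x) := by
  unfold wedge; fun_prop

theorem continuous_matAct (K : GL (Fin 2) ℤ) : Continuous (matAct K) := by
  have e : matAct K = fun x : Quad =>
    ((toReal K.val).mulVec x.1, (toReal K.val).mulVec x.2.1,
      (1 / 2 : ℝ) • coordProd ((toReal K.val).mulVec x.1) ((toReal K.val).mulVec x.2.1)
        + (toReal K.val).mulVec (x.2.2.1 - (1 / 2 : ℝ) • coordProd x.1 x.2.1)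
        + (wedge x.2.1 x.1 / 2) • rowProd (toReal K.val),
      x.2.2.2) := rfl
  rw [e]
  unfold coordProd wedge
  fun_prop

theorem continuous_act (α : ℝ) (g : GroupElt) : Continuous (act α g) :=
  (continuous_matAct g.K).comp ((continuous_transAct α g.k).comp (continuous_scaleAct g.μ g.ρ))

theorem HasPi.add_lattice {α : ℝ} {r : ℕ} {a b c : Fin 2 → ℝ} {p : Fin 2 → ℤ}
    {M : Matrix (Fin 2) (Fin 2) ℤ} (hM : matN α a b = toReal M) (hp : HasPi α r a b c p)
    (s : Fin 2 → ℤ) :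
    HasPi α r a b (c + (wedge b a / (r : ℝ)) • vecReal s) (p + (1 - M).mulVec s) := by
  unfold HasPi at hp ⊢
  have e1 : vecReal (p + (1 - M).mulVec s) = vecReal p + vecReal ((1 - M).mulVec s) := by
    ext; simp [vecReal]
  have e2 : c + (wedge b a / (r : ℝ)) • vecReal s - (1 / 2 : ℝ) • coordProd a b
      = (c - (1 / 2 : ℝ) • coordProd a b) + (wedge b a / (r : ℝ)) • vecReal s := by abel
  rw [e1, smul_add, ← hp, e2, Matrix.mulVec_add, Matrix.mulVec_smul, hM, ← toReal_one_sub,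
    toReal_mulVec_vecReal]
  abel

/-- The map of the parameter space given by `g` followed by translations by lattice elements. Two
parameters represent the same point of the moduli set if and only if such a map takes one to the
other. -/
noncomputable def moveParams {α : ℝ} (h0 : α ≠ 0) (h1 : α ≠ 1) {r : ℕ} (hr : r ≠ 0) (g : GroupElt)
    (s : Fin 2 → ℤ) (s₀ : ℤ) (x : Params α r) : Params α r :=
  ⟨((act α g x.1).1, (act α g x.1).2.1,
    (act α g x.1).2.2.1
      + (wedge (act α g x.1).2.1 (act α g x.1).1 / (r : ℝ)) • vecReal s,
    (act α g x.1).2.2.2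
      + ((wedge (act α g x.1).2.1 (act α g x.1).1 / (r : ℝ) * (s₀ : ℝ) : ℝ) : ℂ)), by
    obtain ⟨h, ⟨p, hp⟩⟩ := act_mem h0 h1 hr g x.2
    obtain ⟨M, hM⟩ := h.2
    exact ⟨h, _, hp.add_lattice hM s⟩⟩

theorem continuous_moveParams {α : ℝ} (h0 : α ≠ 0) (h1 : α ≠ 1) {r : ℕ} (hr : r ≠ 0)
    (g : GroupElt) (s : Fin 2 → ℤ) (s₀ : ℤ) : Continuous (moveParams h0 h1 hr g s s₀) := by
  refine Continuous.subtype_mk ?_ _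
  have h := (continuous_act α g).comp (continuous_subtype_val (p := fun x : Quad =>
    CompatiblePair α x.1 x.2.1 ∧ CompatibleVec α r x.1 x.2.1 x.2.2.1))
  have hw := continuous_wedge h.snd.fst h.fst
  have ha := h.fst
  have hb := h.snd.fst
  have hc := h.snd.snd.fst
  have ht := h.snd.snd.snd
  simp only [Function.comp_apply] at hw ha hb hc ht
  refine ha.prodMk (hb.prodMk (Continuous.prodMk ?_ ?_))
  · exact hc.add ((hw.div_const _).smul continuous_const)
  · exact ht.add (Complex.continuous_ofReal.comp ((hw.div_const _).mul continuous_const))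

theorem isOpenMap_mk {α : ℝ} (h0 : α ≠ 0) (h1 : α ≠ 1) {r : ℕ} (hr : r ≠ 0) :
    IsOpenMap (Quot.mk (OrbitRel α r)) := by
  intro U hU
  rw [← isQuotientMap_quot_mk.isOpen_preimage]
  have e : Quot.mk (OrbitRel α r) ⁻¹' (Quot.mk (OrbitRel α r) '' U)
      = ⋃ (g : GroupElt) (s : Fin 2 → ℤ) (s₀ : ℤ), moveParams h0 h1 hr g s s₀ ⁻¹' U := by
    ext y
    simp only [Set.mem_preimage, Set.mem_image, Set.mem_iUnion]
    constructor
    · rintro ⟨x, hx, hxy⟩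
      obtain ⟨g, hg⟩ := (mk_eq_mk_iff h1 hr).mp hxy.symm
      obtain ⟨e1, e2, ⟨s, e3⟩, ⟨s₀, e4⟩⟩ := sameClass_iff.mp hg
      refine ⟨g, s, s₀, ?_⟩
      convert hx
      exact Subtype.ext (Prod.ext e1.symm (Prod.ext e2.symm (Prod.ext e3.symm e4.symm)))
    · rintro ⟨g, s, s₀, h⟩
      exact ⟨_, h, ((mk_eq_mk_iff h1 hr).mpr ⟨g, sameClass_iff.mpr
        ⟨rfl, rfl, ⟨s, rfl⟩, ⟨s₀, rfl⟩⟩⟩).symm⟩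
  rw [e]
  exact isOpen_iUnion fun g => isOpen_iUnion fun s => isOpen_iUnion fun s₀ =>
    hU.preimage (continuous_moveParams h0 h1 hr g s s₀)

/-- The map `t ↦ [(a,b,c,t)]`. -/
def slice {α : ℝ} {r : ℕ} {a b c : Fin 2 → ℝ} (h : CompatiblePair α a b ∧ CompatibleVec α r a b c)
    (t : ℂ) : Moduli α r := Quot.mk _ ⟨(a, b, c, t), h⟩

theorem continuous_slice {α : ℝ} {r : ℕ} {a b c : Fin 2 → ℝ}
    (h : CompatiblePair α a b ∧ CompatibleVec α r a b c) : Continuous (slice h) :=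
  continuous_quot_mk.comp (Continuous.subtype_mk (by fun_prop) _)

theorem slice_eq_iff {α : ℝ} (h1 : α ≠ 1) {r : ℕ} (hr : r ≠ 0) {a b c : Fin 2 → ℝ}
    (h : CompatiblePair α a b ∧ CompatibleVec α r a b c) {t t' : ℂ} :
    slice h t = slice h t' ↔ ∃ ε τ, Moves α r a b c ε τ ∧ t' = (ε : ℂ) * t + (τ : ℂ) := by
  unfold slice
  rw [mk_eq_mk_iff h1 hr]
  constructor
  · rintro ⟨g, hg⟩
    obtain ⟨τ, hm, e⟩ := moves_of_sameClass hg
    exact ⟨_, τ, hm, e⟩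
  · rintro ⟨ε, τ, hm, rfl⟩
    exact hm.sameClass t

theorem continuous_matN {α : ℝ} {r : ℕ} (i j : Fin 2) :
    Continuous fun x : Params α r => matN α x.1.1 x.1.2.1 i j := by
  have hw : ∀ x : Params α r, wedge x.1.2.1 x.1.1 ≠ 0 := fun x => wedge_ne_zero x.2.1.1
  have hwc : Continuous fun x : Params α r => wedge x.1.2.1 x.1.1 :=
    continuous_wedge (by fun_prop) (by fun_prop)
  have e : ∀ x : Params α r, matN α x.1.1 x.1.2.1 i j = _ :=
    fun x => congrFun (congrFun (matN_apply α (hw x)) i) j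
  simp_rw [e]
  fin_cases i <;> fin_cases j <;> simp <;> exact Continuous.div (by fun_prop) hwc hw

theorem int_cast_eq_of_abs_sub_lt_one {m n : ℤ} (h : |(m : ℝ) - n| < 1) : m = n := by
  have : |m - n| < 1 := by exact_mod_cast h
  rw [Int.abs_lt_one_iff] at this
  omega

theorem HasPi.unique {α : ℝ} (h0 : α ≠ 0) (h1 : α ≠ 1) {r : ℕ} {a b c c' : Fin 2 → ℝ}
    {p : Fin 2 → ℤ} (h : wedge b a ≠ 0) (hp : HasPi α r a b c p) (hp' : HasPi α r a b c' p) :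
    c = c' := by
  unfold HasPi at hp hp'
  have e := hp.trans hp'.symm
  have := Matrix.mulVec_injective_of_isUnit
    ((Matrix.isUnit_iff_isUnit_det _).mpr (isUnit_iff_ne_zero.mpr (det_one_sub_matN h0 h1 h)))
    (sub_left_injective e)
  exact sub_left_injective this

theorem dotProduct_self_nonneg (a : Fin 2 → ℝ) : 0 ≤ a ⬝ᵥ a :=
  Finset.sum_nonneg fun i _ => mul_self_nonneg (a i)

/-- The point `(a',b',c',t')` is on the slice of `(a,b,c)`, up to scaling, when `N(α,a',b')` and
`π(c')` agree with those of `(a,b,c)` and `a'` is a positive multiple of `a`. -/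
theorem mk_eq_slice {α : ℝ} (hα : SPlusAdmissible α) {r : ℕ} (hr : r ≠ 0) {a b c : Fin 2 → ℝ}
    {p : Fin 2 → ℤ} (h : CompatiblePair α a b ∧ CompatibleVec α r a b c) (hp : HasPi α r a b c p)
    (x : Params α r) (hM : matN α x.1.1 x.1.2.1 = matN α a b)
    (hpx : HasPi α r x.1.1 x.1.2.1 x.1.2.2.1 p) (hpos : 0 < x.1.1 ⬝ᵥ a) :
    Quot.mk _ x = slice h (((wedge b a / wedge x.1.2.1 x.1.1 : ℝ) : ℂ) * x.1.2.2.2) := by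
  obtain ⟨⟨a', b', c', t'⟩, hx⟩ := x
  dsimp only at hM hpx hpos ⊢
  have hw := wedge_ne_zero h.1.1
  have hw' : wedge b' a' ≠ 0 := wedge_ne_zero hx.1.1
  have ea := eq_smul_fst hα.one_lt hw (v := a') (by rw [← hM, matN_mulVec_fst α hw'])
  have eb := eq_smul_snd hα.one_lt hw (v := b') (by rw [← hM, matN_mulVec_snd α hw'])
  set μ := wedge b a' / wedge b a
  set ρ := wedge b' a / wedge b a
  have hμ : 0 < μ := by
    rw [ea, smul_dotProduct, smul_eq_mul] at hpos
    exact pos_of_mul_pos_left hpos (dotProduct_self_nonneg a)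
  have hww : wedge b' a' = μ * ρ * wedge b a := by rw [ea, eb, wedge_smul]
  have hρ : ρ ≠ 0 := by
    rintro h0; rw [hww, h0] at hw'; simp at hw'
  have ec : c' = (μ * ρ) • c := by
    have h2 := hp.scale hw hμ.ne' hρ
    rw [← ea, ← eb] at h2
    exact HasPi.unique hα.ne_zero hα.ne_one hw' hpx h2
  refine ((mk_eq_mk_iff hα.ne_one hr).mpr ⟨⟨μ, ρ, 1, 0, hμ, hρ⟩, ?_⟩).symm
  rw [act_scale]
  refine SameClass.of_eq (Prod.ext ea.symm (Prod.ext eb.symm (Prod.ext ec.symm ?_)))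
  change ((μ * ρ : ℝ) : ℂ) * (((wedge b a / wedge b' a' : ℝ) : ℂ) * t') = t'
  have hμρ : (μ * ρ : ℝ) * (wedge b a / wedge b' a') = 1 := by
    rw [hww]; field_simp
  rw [← mul_assoc, ← Complex.ofReal_mul, hμρ, Complex.ofReal_one, one_mul]

/-- The image of `U` is also the image of an open set of parameters: those with the same `N` and the
same `π`, with `a'` in the half-plane of `a`, and with `t'` in `U` after rescaling. -/
theorem isOpenMap_slice {α : ℝ} (hα : SPlusAdmissible α) {r : ℕ} (hr : r ≠ 0) {a b c : Fin 2 → ℝ}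
    (h : CompatiblePair α a b ∧ CompatibleVec α r a b c) : IsOpenMap (slice h) := by
  intro U hU
  obtain ⟨p, hp⟩ := h.2
  obtain ⟨M, hM⟩ := h.1.2
  have hw := wedge_ne_zero h.1.1
  have hr' : (r : ℝ) ≠ 0 := by exact_mod_cast hr
  -- the vector `π_{a',b',r}(c')` as a continuous function of `(a',b',c')`
  let V : Params α r → Fin 2 → ℝ := fun x => ((r : ℝ) / wedge x.1.2.1 x.1.1) •
    ((1 - matN α x.1.1 x.1.2.1).mulVec (x.1.2.2.1 - (1 / 2 : ℝ) • coordProd x.1.1 x.1.2.1)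
      - (wedge x.1.2.1 x.1.1 / 2) • rowProd (matN α x.1.1 x.1.2.1))
  have hV : ∀ (x : Params α r) (q : Fin 2 → ℤ),
      HasPi α r x.1.1 x.1.2.1 x.1.2.2.1 q ↔ V x = vecReal q := by
    intro x q
    have hwx := wedge_ne_zero x.2.1.1
    have hu : (r : ℝ) / wedge x.1.2.1 x.1.1 ≠ 0 := div_ne_zero hr' hwx
    have hi : wedge x.1.2.1 x.1.1 / (r : ℝ) = ((r : ℝ) / wedge x.1.2.1 x.1.1)⁻¹ := by
      rw [inv_div]
    unfold HasPi
    rw [hi, eq_inv_smul_iff₀ hu]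
  have hwc : Continuous fun x : Params α r => wedge x.1.2.1 x.1.1 :=
    continuous_wedge (by fun_prop) (by fun_prop)
  have hVc : ∀ i, Continuous fun x => V x i := by
    intro i
    have hn := fun i j => continuous_matN (α := α) (r := r) i j
    have e : (fun x => V x i) = fun x : Params α r => ((r : ℝ) / wedge x.1.2.1 x.1.1) *
        ((x.1.2.2.1 i - 1 / 2 * (x.1.1 i * x.1.2.1 i))
          - (matN α x.1.1 x.1.2.1 i 0 * (x.1.2.2.1 0 - 1 / 2 * (x.1.1 0 * x.1.2.1 0))
            + matN α x.1.1 x.1.2.1 i 1 * (x.1.2.2.1 1 - 1 / 2 * (x.1.1 1 * x.1.2.1 1)))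
          - (wedge x.1.2.1 x.1.1 / 2) * (matN α x.1.1 x.1.2.1 i 0 * matN α x.1.1 x.1.2.1 i 1)) := by
      funext x
      simp only [V, Matrix.sub_mulVec, Matrix.one_mulVec]
      simp only [Pi.smul_apply, Pi.sub_apply, smul_eq_mul, coordProd, rowProd, Matrix.mulVec,
        dotProduct, Fin.sum_univ_two]
    rw [e]
    have h0 := hn i 0
    have h1 := hn i 1
    have hd : Continuous fun x : Params α r => (r : ℝ) / wedge x.1.2.1 x.1.1 :=
      continuous_const.div hwc fun x => wedge_ne_zero x.2.1.1
    fun_prop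
  -- the first two conditions force equality, because both quantities are integral
  let Ω : Set (Params α r) := (⋂ i, ⋂ j, {x | |matN α x.1.1 x.1.2.1 i j - (M i j : ℝ)| < 1})
    ∩ (⋂ i, {x | |V x i - (p i : ℝ)| < 1}) ∩ {x | 0 < x.1.1 ⬝ᵥ a}
    ∩ {x | ((wedge b a / wedge x.1.2.1 x.1.1 : ℝ) : ℂ) * x.1.2.2.2 ∈ U}
  have hΩ : IsOpen Ω := by
    refine IsOpen.inter (IsOpen.inter (IsOpen.inter ?_ ?_) ?_) ?_
    · exact isOpen_iInter_of_finite fun i => isOpen_iInter_of_finite fun j =>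
        isOpen_lt ((continuous_matN i j).sub continuous_const).abs continuous_const
    · exact isOpen_iInter_of_finite fun i =>
        isOpen_lt ((hVc i).sub continuous_const).abs continuous_const
    · refine isOpen_lt continuous_const ?_
      simp only [dotProduct, Fin.sum_univ_two]
      fun_prop
    · refine hU.preimage ?_
      have hd : Continuous fun x : Params α r => wedge b a / wedge x.1.2.1 x.1.1 :=
        continuous_const.div hwc fun x => wedge_ne_zero x.2.1.1
      fun_prop
  have key : ∀ x ∈ Ω, Quot.mk _ x
      = slice h (((wedge b a / wedge x.1.2.1 x.1.1 : ℝ) : ℂ) * x.1.2.2.2) := by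
    rintro x ⟨⟨⟨h1, h2⟩, h3⟩, -⟩
    simp only [Set.mem_iInter] at h1 h2
    obtain ⟨M', hM'⟩ := x.2.1.2
    obtain ⟨p', hp'⟩ := x.2.2
    have eM : M' = M := by
      ext i j
      have := h1 i j
      change |matN α x.1.1 x.1.2.1 i j - (M i j : ℝ)| < 1 at this
      rw [hM'] at this
      exact int_cast_eq_of_abs_sub_lt_one this
    have ep : p' = p := by
      ext i
      have := h2 i
      change |V x i - (p i : ℝ)| < 1 at this
      rw [(hV x p').mp hp'] at this
      exact int_cast_eq_of_abs_sub_lt_one this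
    exact mk_eq_slice hα hr h hp x (by rw [hM', hM, eM]) (ep ▸ hp') h3
  have e : slice h '' U = Quot.mk (OrbitRel α r) '' Ω := by
    apply Set.Subset.antisymm
    · rintro _ ⟨t, ht, rfl⟩
      refine ⟨⟨(a, b, c, t), h⟩, ⟨⟨⟨?_, ?_⟩, ?_⟩, ?_⟩, rfl⟩
      · simp only [Set.mem_iInter]
        intro i j
        change |matN α a b i j - (M i j : ℝ)| < 1
        rw [hM]; simp [toReal]
      · simp only [Set.mem_iInter]
        intro i
        change |V ⟨(a, b, c, t), h⟩ i - (p i : ℝ)| < 1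
        rw [(hV ⟨(a, b, c, t), h⟩ p).mp hp]; simp [vecReal]
      · change 0 < a ⬝ᵥ a
        have ha : a ≠ 0 := h.1.1.ne_zero 0
        exact lt_of_le_of_ne (dotProduct_self_nonneg a) fun h' =>
          ha (dotProduct_self_eq_zero.mp h'.symm)
      · change ((wedge b a / wedge b a : ℝ) : ℂ) * t ∈ U
        rw [div_self hw]; simpa using ht
    · rintro _ ⟨x, hx, rfl⟩
      rw [key x hx]
      exact ⟨_, hx.2, rfl⟩
  rw [e]
  exact isOpenMap_mk hα.ne_zero hα.ne_one hr Ω hΩ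

/-! ### The covers `exp : ℂ → ℂˣ` and `cos : ℂ → ℂ` -/

/-- The universal cover `t ↦ exp (c t)` of `ℂˣ`. -/
noncomputable def expUnit (c t : ℂ) : ℂˣ := Units.mk0 (Complex.exp (c * t)) (Complex.exp_ne_zero _)

theorem mdifferentiable_units_val :
    MDifferentiable 𝓘(ℂ, ℂ) 𝓘(ℂ, ℂ) (Units.val : ℂˣ → ℂ) :=
  (Units.contMDiff_val (n := 1)).mdifferentiable one_ne_zero

theorem mdifferentiableAt_units {f : ℂ → ℂˣ} {t : ℂ}
    (hf : DifferentiableAt ℂ (fun t => (f t : ℂ)) t) : MDifferentiableAt 𝓘(ℂ, ℂ) 𝓘(ℂ, ℂ) f t := by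
  have h := contMDiffOn_isOpenEmbedding_symm (I := 𝓘(ℂ, ℂ)) (n := 1)
    (Units.isOpenEmbedding_val (R := ℂ))
  set ψ := ((Units.isOpenEmbedding_val (R := ℂ)).toOpenPartialHomeomorph Units.val).symm with hψ
  have hψf : (ψ ∘ fun t => (f t : ℂ)) = f := by
    funext s
    exact ((Units.isOpenEmbedding_val (R := ℂ)).toOpenPartialHomeomorph Units.val).left_inv
      (x := f s) (by simp)
  have h1 : MDifferentiableAt 𝓘(ℂ, ℂ) 𝓘(ℂ, ℂ) ψ (f t : ℂ) :=
    ((h.mdifferentiableOn one_ne_zero) _ ⟨f t, rfl⟩).mdifferentiableAt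
      ((Units.isOpenEmbedding_val (R := ℂ)).isOpen_range.mem_nhds ⟨f t, rfl⟩)
  rw [← hψf]
  exact h1.comp t (mdifferentiableAt_iff_differentiableAt.mpr hf)

theorem continuous_expUnit (c : ℂ) : Continuous (expUnit c) := by
  rw [(Units.isOpenEmbedding_val (R := ℂ)).continuous_iff]
  change Continuous fun t => Complex.exp (c * t)
  fun_prop

theorem isOpenMap_of_differentiable {f : ℂ → ℂ} (hf : Differentiable ℂ f) {x y : ℂ}
    (h : f x ≠ f y) : IsOpenMap f := by
  refine (hf.differentiableOn.analyticOnNhd isOpen_univ).is_constant_or_isOpenMap.resolve_left ?_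
  rintro ⟨w, hw⟩
  exact h ((hw x).trans (hw y).symm)

theorem isOpenMap_expUnit {c : ℂ} (hc : c ≠ 0) : IsOpenMap (expUnit c) := by
  rw [(Units.isOpenEmbedding_val (R := ℂ)).isOpenMap_iff]
  change IsOpenMap fun t => Complex.exp (c * t)
  refine isOpenMap_of_differentiable (by fun_prop) (x := 0) (y := (Real.pi * Complex.I) / c) ?_
  rw [mul_div_cancel₀ _ hc]
  simp only [mul_zero, Complex.exp_zero, Complex.exp_pi_mul_I]
  norm_num

theorem surjective_expUnit {c : ℂ} (hc : c ≠ 0) : Function.Surjective (expUnit c) := by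
  intro u
  refine ⟨Complex.log u / c, Units.ext ?_⟩
  change Complex.exp (c * (Complex.log u / c)) = u
  rw [mul_div_cancel₀ _ hc, Complex.exp_log u.ne_zero]

theorem mdifferentiableOn_expUnit_iff {c : ℂ} (hc : c ≠ 0) {W : Set ℂˣ} (hW : IsOpen W)
    (f : ℂˣ → ℂ) : DifferentiableOn ℂ (f ∘ expUnit c) (expUnit c ⁻¹' W) ↔
      MDifferentiableOn 𝓘(ℂ, ℂ) 𝓘(ℂ, ℂ) f W := by
  have hW' := hW.preimage (continuous_expUnit c)
  constructor
  · intro h y hy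
    obtain ⟨t₀, rfl⟩ := surjective_expUnit hc y
    apply MDifferentiableAt.mdifferentiableWithinAt
    -- the branch of the logarithm around `t₀`
    set z := Complex.exp (c * t₀) with hz
    have hz0 : z ≠ 0 := Complex.exp_ne_zero _
    let L : ℂ → ℂ := fun w => t₀ + Complex.log (w / z) / c
    have hL : ∀ u : ℂˣ, expUnit c (L u) = u := by
      intro u
      apply Units.ext
      change Complex.exp (c * (t₀ + Complex.log (u / z) / c)) = u
      rw [mul_add, mul_div_cancel₀ _ hc, Complex.exp_add,
        Complex.exp_log (div_ne_zero u.ne_zero hz0), ← hz, mul_div_cancel₀ _ hz0]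
    have hL0 : L z = t₀ := by simp [L, hz0]
    have hLd : DifferentiableAt ℂ L z := by
      have : z / z ∈ Complex.slitPlane := by
        rw [div_self hz0]; exact Complex.one_mem_slitPlane
      have h1 : DifferentiableAt ℂ (fun w => Complex.log (w / z)) z :=
        (differentiableAt_id.div_const z).clog this
      exact (differentiableAt_const _).add (h1.div_const _)
    have hf : f = (f ∘ expUnit c) ∘ (L ∘ Units.val) := by
      funext u
      exact congrArg f (hL u).symm
    have h1 : DifferentiableAt ℂ (f ∘ expUnit c) (L z) := by
      rw [hL0]
      exact (h t₀ hy).differentiableAt (hW'.mem_nhds hy)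
    have h2 : MDifferentiableAt 𝓘(ℂ, ℂ) 𝓘(ℂ, ℂ) (((f ∘ expUnit c) ∘ L) ∘ Units.val)
        (expUnit c t₀) := by
      refine MDifferentiableAt.comp (I' := 𝓘(ℂ, ℂ)) (expUnit c t₀)
        (mdifferentiableAt_iff_differentiableAt.mpr ?_) (mdifferentiable_units_val _)
      exact DifferentiableAt.comp z h1 hLd
    rw [hf]
    exact h2
  · intro h t ht
    apply DifferentiableAt.differentiableWithinAt
    rw [← mdifferentiableAt_iff_differentiableAt]
    refine MDifferentiableAt.comp (I' := 𝓘(ℂ, ℂ)) t ((h _ ht).mdifferentiableAt (hW.mem_nhds ht))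
      (mdifferentiableAt_units ?_)
    change DifferentiableAt ℂ (fun t => Complex.exp (c * t)) t
    fun_prop

/-- The quotient map of `ℂ` by the translations by `(2π/c) ℤ` and the inversion about `s`. -/
noncomputable def cosMap (c s t : ℂ) : ℂ := Complex.cos (c * (t - s))

theorem differentiable_cosMap (c s : ℂ) : Differentiable ℂ (cosMap c s) := by
  unfold cosMap; fun_prop

theorem isOpenMap_cosMap {c : ℂ} (hc : c ≠ 0) (s : ℂ) : IsOpenMap (cosMap c s) := by
  refine isOpenMap_of_differentiable (differentiable_cosMap c s) (x := s) (y := s + Real.pi / c) ?_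
  unfold cosMap
  rw [add_sub_cancel_left, mul_div_cancel₀ _ hc, sub_self, mul_zero, Complex.cos_zero,
    Complex.cos_pi]
  norm_num

theorem surjective_cosMap {c : ℂ} (hc : c ≠ 0) (s : ℂ) : Function.Surjective (cosMap c s) := by
  intro y
  obtain ⟨u, hu⟩ := Complex.cos_surjective y
  refine ⟨s + u / c, ?_⟩
  unfold cosMap
  rw [add_sub_cancel_left, mul_div_cancel₀ _ hc, hu]

/-- A function is holomorphic if its pullback under `cosMap` is: away from the critical values
`±1` the map has local inverses, and the critical values are removable singularities. -/
theorem mdifferentiableOn_cosMap_iff {c : ℂ} (hc : c ≠ 0) (s : ℂ) {W : Set ℂ} (hW : IsOpen W)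
    (f : ℂ → ℂ) : DifferentiableOn ℂ (f ∘ cosMap c s) (cosMap c s ⁻¹' W) ↔
      MDifferentiableOn 𝓘(ℂ, ℂ) 𝓘(ℂ, ℂ) f W := by
  have hE := differentiable_cosMap c s
  have hW' := hW.preimage hE.continuous
  rw [mdifferentiableOn_iff_differentiableOn]
  constructor
  · intro h
    have hcont : ∀ y ∈ W, ContinuousAt f y := by
      intro y hy
      obtain ⟨t, rfl⟩ := surjective_cosMap hc s y
      have h1 : ContinuousAt (f ∘ cosMap c s) t :=
        ((h t hy).differentiableAt (hW'.mem_nhds hy)).continuousAt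
      exact (Filter.tendsto_map'_iff.mpr h1).mono_left ((isOpenMap_cosMap hc s).nhds_le t)
    have hreg : ∀ y ∈ W, y ≠ 1 → y ≠ -1 → DifferentiableAt ℂ f y := by
      intro y hy h1 h2
      obtain ⟨t, rfl⟩ := surjective_cosMap hc s y
      have hd : HasStrictDerivAt (cosMap c s) (-Complex.sin (c * (t - s)) * c) t := by
        have h3 : HasStrictDerivAt (fun t => c * (t - s)) c t := by
          have h4 : HasStrictDerivAt (fun t : ℂ => t - s) 1 t := (hasStrictDerivAt_id t).sub_const s
          simpa using HasStrictDerivAt.const_mul c h4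
        exact (Complex.hasStrictDerivAt_cos _).comp t h3
      have hd0 : -Complex.sin (c * (t - s)) * c ≠ 0 := by
        refine mul_ne_zero (neg_ne_zero.mpr fun h0 => ?_) hc
        have h4 := Complex.sin_sq_add_cos_sq (c * (t - s))
        rw [h0] at h4
        have h5 : cosMap c s t * cosMap c s t = 1 := by unfold cosMap; linear_combination h4
        rcases mul_self_eq_one_iff.mp h5 with h5 | h5
        · exact h1 h5
        · exact h2 h5
      have hL := (hd.to_localInverse hd0).hasDerivAt.differentiableAt
      have hL0 : hd.localInverse _ _ _ hd0 (cosMap c s t) = t :=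
        (hd.hasStrictFDerivAt_equiv hd0).localInverse_apply_image
      have h6 : DifferentiableAt ℂ ((f ∘ cosMap c s) ∘ hd.localInverse _ _ _ hd0)
          (cosMap c s t) := by
        refine DifferentiableAt.comp _ ?_ hL
        rw [hL0]
        exact (h t hy).differentiableAt (hW'.mem_nhds hy)
      refine h6.congr_of_eventuallyEq ?_
      filter_upwards [hd.eventually_right_inverse hd0] with x hx
      simp only [Function.comp_apply, hx]
    have hrem : ∀ y ∈ W, y * y = 1 → DifferentiableAt ℂ f y := by
      intro y hy hy1
      have hyy : y ≠ -y := by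
        intro h0
        have : y = 0 := by linear_combination h0 / 2
        rw [this] at hy1; norm_num at hy1
      have hS : W \ {-y} ∈ nhds y :=
        (hW.sdiff isClosed_singleton).mem_nhds ⟨hy, hyy⟩
      have := (Complex.differentiableOn_compl_singleton_and_continuousAt_iff (f := f) hS).mp
        ⟨fun z hz => ?_, hcont y hy⟩
      · exact this.differentiableAt hS
      · apply DifferentiableAt.differentiableWithinAt
        have hz1 : z ≠ y := hz.2
        have hz2 : z ≠ -y := hz.1.2
        rcases mul_self_eq_one_iff.mp hy1 with rfl | rfl
        · exact hreg z hz.1.1 hz1 hz2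
        · rw [neg_neg] at hz2
          exact hreg z hz.1.1 hz2 hz1
    intro y hy
    apply DifferentiableAt.differentiableWithinAt
    by_cases h1 : y * y = 1
    · exact hrem y hy h1
    · refine hreg y hy ?_ ?_
      · rintro rfl; exact h1 (by norm_num)
      · rintro rfl; exact h1 (by norm_num)
  · intro h
    exact h.comp hE.differentiableOn (Set.mapsTo_preimage _ _)

/-- `ℂ` and `ℂˣ` are not homeomorphic: otherwise there would be a continuous logarithm
on `ℂˣ`. -/
theorem not_homeomorph_units : IsEmpty (ℂ ≃ₜ ℂˣ) := by
  refine ⟨fun e => ?_⟩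
  have hsc : IsSimplyConnected (Set.univ : Set ℂ) := by
    have := (convex_univ (𝕜 := ℝ) (E := ℂ)).contractibleSpace Set.univ_nonempty
    exact (inferInstance : SimplyConnectedSpace (Set.univ : Set ℂ))
  obtain ⟨g, hg, hge⟩ := Complex.exists_continuousOn_eqOn_exp_comp (X := ℂ) (U := Set.univ)
    hsc isOpen_univ
    (g := fun z => ((e z : ℂˣ) : ℂ)) (by
      refine Continuous.continuousOn ?_
      exact Units.continuous_val.comp e.continuous) (by rintro ⟨z, -, hz⟩; exact (e z).ne_zero hz)
  have hg' : Continuous g := continuousOn_univ.mp hg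
  let h : ℝ → ℂ := fun θ => g (e.symm (expUnit Complex.I θ)) - Complex.I * θ
  have hc : Continuous h := by
    have h1 : Continuous fun θ : ℝ => expUnit Complex.I (θ : ℂ) :=
      (continuous_expUnit Complex.I).comp Complex.continuous_ofReal
    exact (hg'.comp (e.symm.continuous.comp h1)).sub (by fun_prop)
  have hexp : ∀ θ, ∃ n : ℤ, h θ = n * (2 * Real.pi * Complex.I) := by
    intro θ
    rw [← Complex.exp_eq_one_iff, Complex.exp_sub]
    have h2 : Complex.exp (g (e.symm (expUnit Complex.I θ))) = Complex.exp (Complex.I * θ) := by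
      have := hge (Set.mem_univ (e.symm (expUnit Complex.I (θ : ℂ))))
      simp only [Function.comp_apply, Homeomorph.apply_symm_apply] at this
      exact this
    rw [h2, div_self (Complex.exp_ne_zero _)]
  have hper : h (2 * Real.pi) = h 0 - 2 * Real.pi * Complex.I := by
    have : expUnit Complex.I ((2 * Real.pi : ℝ) : ℂ) = expUnit Complex.I ((0 : ℝ) : ℂ) := by
      apply Units.ext
      change Complex.exp (Complex.I * ((2 * Real.pi : ℝ) : ℂ)) = Complex.exp (Complex.I * (0 : ℝ))
      rw [Complex.ofReal_zero, mul_zero, Complex.exp_zero, Complex.exp_eq_one_iff]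
      exact ⟨1, by push_cast; ring⟩
    simp only [h]
    rw [this]
    push_cast
    ring
  -- `h / 2πi` is a continuous function with integral values
  choose n hn using hexp
  have hpi : (2 * Real.pi * Complex.I : ℂ) ≠ 0 := Complex.two_pi_I_ne_zero
  have hnc : Continuous n := by
    rw [Int.isClosedEmbedding_coe_real.isInducing.continuous_iff]
    have e1 : (fun θ => ((n θ : ℤ) : ℝ)) = fun θ => (h θ / (2 * Real.pi * Complex.I)).re := by
      funext θ
      rw [hn, mul_div_cancel_right₀ _ hpi, Complex.intCast_re]
    change Continuous fun θ => ((n θ : ℤ) : ℝ)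
    rw [e1]
    exact Complex.continuous_re.comp (hc.div_const _)
  have hconst : n (2 * Real.pi) = n 0 :=
    isPreconnected_univ.constant hnc.continuousOn (Set.mem_univ _) (Set.mem_univ _)
  rw [hn, hn, hconst] at hper
  exact hpi (by linear_combination hper)

/-! ### The components of a fibre -/

theorem orbitPart_eq_range {α : ℝ} {r : ℕ} (h1 : α ≠ 1) (hr : r ≠ 0) {a b c : Fin 2 → ℝ}
    (h : CompatiblePair α a b ∧ CompatibleVec α r a b c) :
    orbitPart α r a b c = Set.range (slice h) := by
  ext q
  constructor
  · rintro ⟨⟨⟨a', b', c', t'⟩, hx⟩, rfl, rfl, rfl, g, hg, hm⟩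
    have hμρ : g.μ * g.ρ ≠ 0 := mul_ne_zero g.μ_pos.ne' g.ρ_ne
    have hμρ' : ((g.μ * g.ρ : ℝ) : ℂ) ≠ 0 := by exact_mod_cast hμρ
    obtain ⟨τ, hτ, -⟩ := sameClass_affine (sameClass_of_mem_pairStab hg hm 0)
    refine ⟨(t' - τ) / ((g.μ * g.ρ : ℝ) : ℂ), (mk_eq_mk_iff h1 hr).mpr ⟨g, ?_⟩⟩
    have := hτ ((t' - τ) / ((g.μ * g.ρ : ℝ) : ℂ))
    rwa [mul_div_cancel₀ _ hμρ', sub_add_cancel] at this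
  · rintro ⟨t, rfl⟩
    refine ⟨⟨(a, b, c, t), h⟩, rfl, rfl, rfl, 1, ?_, 0, ?_⟩
    · exact (mem_pairStab_iff (α := α) (c := c) (t := t)).mpr (by rw [act_one]; exact ⟨rfl, rfl⟩)
    · rw [act_one]; ext; simp [vecReal]

/-- Applied in both directions: two slices over the same `(a,b)` coincide or are disjoint. -/
theorem range_slice_subset {α : ℝ} {r : ℕ} (h1 : α ≠ 1) (hr : r ≠ 0) {a b c c' : Fin 2 → ℝ}
    (h : CompatiblePair α a b ∧ CompatibleVec α r a b c)
    (h' : CompatiblePair α a b ∧ CompatibleVec α r a b c') {t t' : ℂ}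
    (e : slice h t = slice h' t') : Set.range (slice h) ⊆ Set.range (slice h') := by
  rintro _ ⟨t₁, rfl⟩
  obtain ⟨g, hg⟩ := (mk_eq_mk_iff h1 hr).mp e
  obtain ⟨τ, hτ, -⟩ := sameClass_affine hg
  exact ⟨_, ((mk_eq_mk_iff h1 hr).mpr ⟨g, hτ t₁⟩).symm⟩

theorem pairRel_equivalence (α : ℝ) : Equivalence (PairRel α) where
  refl x := ⟨1, by simp [toReal_one], by simp [toReal_one]⟩
  symm := by
    rintro x y ⟨g, h1, h2⟩
    have hK : toReal g.K⁻¹.val * toReal g.K.val = 1 := by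
      rw [← toReal_mul, ← toReal_one, ← Units.val_mul]; simp
    refine ⟨g⁻¹, ?_, ?_⟩
    · rw [h1, Matrix.mulVec_smul, GroupElt.inv_K, GroupElt.inv_μ, Matrix.mulVec_mulVec, hK,
        Matrix.one_mulVec, smul_smul, inv_mul_cancel₀ g.μ_pos.ne', one_smul]
    · rw [h2, Matrix.mulVec_smul, GroupElt.inv_K, GroupElt.inv_ρ, Matrix.mulVec_mulVec, hK,
        Matrix.one_mulVec, smul_smul, inv_mul_cancel₀ g.ρ_ne, one_smul]
  trans := by
    rintro x y z ⟨g, h1, h2⟩ ⟨g', h1', h2'⟩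
    refine ⟨g' * g, ?_, ?_⟩
    · rw [h1', h1, Matrix.mulVec_smul, smul_smul, Matrix.mulVec_mulVec, ← toReal_mul]; rfl
    · rw [h2', h2, Matrix.mulVec_smul, smul_smul, Matrix.mulVec_mulVec, ← toReal_mul]; rfl

theorem slice_mem_fibre {α : ℝ} {r : ℕ} (P : Pairs α) {c : Fin 2 → ℝ}
    (h : CompatiblePair α P.1.1 P.1.2 ∧ CompatibleVec α r P.1.1 P.1.2 c) (t : ℂ) :
    slice h t ∈ fibre r P := rfl

theorem exists_slice_of_mem_fibre {α : ℝ} (h0 : α ≠ 0) (h1 : α ≠ 1) {r : ℕ} (hr : r ≠ 0)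
    {P : Pairs α} {q : Moduli α r} (hq : q ∈ fibre r P) :
    ∃ (c : Fin 2 → ℝ) (h : CompatiblePair α P.1.1 P.1.2 ∧ CompatibleVec α r P.1.1 P.1.2 c) (t : ℂ),
      q = slice h t := by
  induction q using Quot.ind with
  | mk x =>
    have hq' : (Quot.mk (PairRel α) (pairOf x) : PairClasses α) = Quot.mk _ P := hq
    rw [(pairRel_equivalence α).quot_mk_eq_iff] at hq'
    obtain ⟨g, e1, e2⟩ := hq'
    obtain ⟨⟨a, b, c, t⟩, hx⟩ := x
    have e1' : P.1.1 = (act α g (a, b, c, t)).1 := by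
      rw [e1]; exact (Matrix.mulVec_smul _ _ _).symm
    have e2' : P.1.2 = (act α g (a, b, c, t)).2.1 := by
      rw [e2]; exact (Matrix.mulVec_smul _ _ _).symm
    have hm := act_mem h0 h1 hr g hx
    rw [← e1', ← e2'] at hm
    refine ⟨(act α g (a, b, c, t)).2.2.1, hm, (act α g (a, b, c, t)).2.2.2,
      (mk_eq_mk_iff h1 hr).mpr ⟨g, ?_⟩⟩
    exact SameClass.of_eq (Prod.ext e1'.symm (Prod.ext e2'.symm rfl))

/-- The slices over `(a,b)` are open and connected and partition the fibre. -/
theorem connectedComponentIn_fibre {α : ℝ} (hα : SPlusAdmissible α) {r : ℕ} (hr : r ≠ 0)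
    {P : Pairs α} {c : Fin 2 → ℝ}
    (h : CompatiblePair α P.1.1 P.1.2 ∧ CompatibleVec α r P.1.1 P.1.2 c) (t : ℂ) :
    connectedComponentIn (fibre r P) (slice h t) = Set.range (slice h) := by
  apply Set.Subset.antisymm
  -- `S` is the union of the other slices
  · let S : Set (Moduli α r) := {q | ∃ (c' : Fin 2 → ℝ)
      (h' : CompatiblePair α P.1.1 P.1.2 ∧ CompatibleVec α r P.1.1 P.1.2 c'),
      q ∈ Set.range (slice h') ∧ q ∉ Set.range (slice h)}
    have hSo : IsOpen S := by
      rw [isOpen_iff_forall_mem_open]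
      rintro q ⟨c', h', ⟨t', rfl⟩, hq⟩
      refine ⟨Set.range (slice h'), ?_, (isOpenMap_slice hα hr h').isOpen_range, ⟨t', rfl⟩⟩
      rintro _ ⟨t₁, rfl⟩
      refine ⟨c', h', ⟨t₁, rfl⟩, ?_⟩
      rintro ⟨t₂, e⟩
      exact hq (range_slice_subset hα.ne_one hr h' h e.symm ⟨t', rfl⟩)
    refine IsPreconnected.subset_left_of_subset_union (isOpenMap_slice hα hr h).isOpen_range hSo
      ?_ ?_ ⟨slice h t, mem_connectedComponentIn (slice_mem_fibre P h t), ⟨t, rfl⟩⟩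
      isPreconnected_connectedComponentIn
    · rw [Set.disjoint_left]
      rintro q hq ⟨c', h', -, hq'⟩
      exact hq' hq
    · intro q hq
      obtain ⟨c', h', t', rfl⟩ := exists_slice_of_mem_fibre hα.ne_zero hα.ne_one hr
        (connectedComponentIn_subset _ _ hq)
      by_cases hm : slice h' t' ∈ Set.range (slice h)
      · exact Or.inl hm
      · exact Or.inr ⟨c', h', ⟨t', rfl⟩, hm⟩
  · refine (isPreconnected_range (continuous_slice h)).subset_connectedComponentIn ⟨t, rfl⟩ ?_
    rintro _ ⟨t', rfl⟩
    exact slice_mem_fibre P h t'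

/-! ### The complex structure of a component -/

/-- Only the given slice matters: the other slices that meet `V` are affine reparametrisations
of it. -/
theorem holomorphicOn_iff {α : ℝ} {r : ℕ} (h1 : α ≠ 1) (hr : r ≠ 0) {a b c : Fin 2 → ℝ}
    (h : CompatiblePair α a b ∧ CompatibleVec α r a b c) (F : Moduli α r → ℂ)
    {V : Set (Moduli α r)} (hV : V ⊆ Set.range (slice h)) :
    HolomorphicOn F V ↔ DifferentiableOn ℂ (F ∘ slice h) (slice h ⁻¹' V) := by
  constructor
  · intro hF
    exact hF a b c h
  · intro hF a' b' c' h' t₀ ht₀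
    obtain ⟨t₁, ht₁⟩ := hV ht₀
    obtain ⟨g, hg⟩ := (mk_eq_mk_iff h1 hr).mp ht₁.symm
    obtain ⟨τ, hτ, -⟩ := sameClass_affine hg
    have key : ∀ t : ℂ, (Quot.mk _ ⟨(a', b', c', t), h'⟩ : Moduli α r)
        = slice h (((g.μ * g.ρ : ℝ) : ℂ) * t + τ) := fun t =>
      (mk_eq_mk_iff h1 hr).mpr ⟨g, hτ t⟩
    have hA : DifferentiableOn ℂ (fun t : ℂ => ((g.μ * g.ρ : ℝ) : ℂ) * t + τ)
        {t : ℂ | Quot.mk (OrbitRel α r) ⟨(a', b', c', t), h'⟩ ∈ V} := by fun_prop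
    have := hF.comp hA (fun t ht => by
      change slice h _ ∈ V
      rw [← key]; exact ht)
    refine (this.congr fun t _ => ?_) t₀ ht₀
    change F _ = F _
    rw [key]

/-- A component is biholomorphic to every quotient of `ℂ` by the same identifications. -/
theorem biholomorphic_range_slice {α : ℝ} (hα : SPlusAdmissible α) {r : ℕ} (hr : r ≠ 0)
    {a b c : Fin 2 → ℝ} (h : CompatiblePair α a b ∧ CompatibleVec α r a b c)
    {Y : Type} [TopologicalSpace Y] [ChartedSpace ℂ Y] (E : ℂ → Y) (hEc : Continuous E)
    (hEo : IsOpenMap E) (hEs : Function.Surjective E)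
    (hker : ∀ t t', slice h t = slice h t' ↔ E t = E t')
    (hdiff : ∀ W : Set Y, IsOpen W → ∀ f : Y → ℂ, DifferentiableOn ℂ (f ∘ E) (E ⁻¹' W) ↔
      MDifferentiableOn 𝓘(ℂ, ℂ) 𝓘(ℂ, ℂ) f W) :
    Biholomorphic (Set.range (slice h)) Y := by
  let s : ℂ → Set.range (slice h) := Set.rangeFactorization (slice h)
  have hsc : Continuous s := (continuous_slice h).subtype_mk _
  have hso : IsOpenMap s := (isOpenMap_slice hα hr h).subtype_mk _
  have hss : Function.Surjective s := Set.rangeFactorization_surjective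
  have hsk : ∀ t t', s t = s t' ↔ E t = E t' := fun t t' => by
    rw [← hker]; exact Subtype.ext_iff
  let e' : Set.range (slice h) → Y := fun q => E (hss q).choose
  have he' : ∀ t, e' (s t) = E t := fun t => (hsk _ _).mp (hss (s t)).choose_spec
  have hhom : IsHomeomorph e' := by
    refine ⟨?_, ?_, ?_, ?_⟩
    · rw [(hso.isQuotientMap hsc hss).continuous_iff]
      exact hEc.congr fun t => (he' t).symm
    · intro U hU
      have : e' '' U = E '' (s ⁻¹' U) := by
        ext y
        constructor
        · rintro ⟨q, hq, rfl⟩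
          obtain ⟨t, rfl⟩ := hss q
          exact ⟨t, hq, (he' t).symm⟩
        · rintro ⟨t, ht, rfl⟩
          exact ⟨s t, ht, he' t⟩
      rw [this]
      exact hEo _ (hU.preimage hsc)
    · intro q q' hqq
      obtain ⟨t, rfl⟩ := hss q
      obtain ⟨t', rfl⟩ := hss q'
      rw [he', he'] at hqq
      exact (hsk t t').mpr hqq
    · intro y
      obtain ⟨t, rfl⟩ := hEs y
      exact ⟨s t, he' t⟩
  refine ⟨hhom.homeomorph e', fun W hW F => ?_⟩
  rw [holomorphicOn_iff hα.ne_one hr h F (by rintro _ ⟨q, -, rfl⟩; exact q.2), ← hdiff W hW]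
  have e1 : slice h ⁻¹' (Subtype.val '' ((hhom.homeomorph e') ⁻¹' W)) = E ⁻¹' W := by
    ext t
    simp only [Set.mem_preimage, Set.mem_image]
    constructor
    · rintro ⟨q, hq, hqt⟩
      have : q = s t := Subtype.ext hqt
      rw [this] at hq
      rw [← he']; exact hq
    · intro ht
      exact ⟨s t, by change e' (s t) ∈ W; rwa [he'], rfl⟩
  have e2 : F ∘ slice h = (fun y : Y => F ((hhom.homeomorph e').symm y)) ∘ E := by
    funext t
    have : (hhom.homeomorph e').symm (E t) = s t := by
      rw [Homeomorph.symm_apply_eq]; exact (he' t).symm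
    change F _ = F _
    rw [this]
    rfl
  rw [e1, e2]

theorem biholomorphic_units_of_not_moves {α : ℝ} (hα : SPlusAdmissible α) {r : ℕ} (hr : r ≠ 0)
    {a b c : Fin 2 → ℝ} (h : CompatiblePair α a b ∧ CompatibleVec α r a b c)
    (hC : ¬∃ τ, Moves α r a b c (-1) τ) : Biholomorphic (Set.range (slice h)) ℂˣ := by
  obtain ⟨p, hp⟩ := h.2
  obtain ⟨l, hl, hT⟩ := exists_translations_eq hα hr h.1 hp
  have hl' : (l : ℂ) ≠ 0 := by exact_mod_cast hl
  have hc : (2 * Real.pi * Complex.I / l : ℂ) ≠ 0 := div_ne_zero Complex.two_pi_I_ne_zero hl'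
  refine biholomorphic_range_slice hα hr h (expUnit (2 * Real.pi * Complex.I / l))
    (continuous_expUnit _) (isOpenMap_expUnit hc) (surjective_expUnit hc) (fun t t' => ?_)
    (fun W hW f => mdifferentiableOn_expUnit_iff hc hW f)
  rw [slice_eq_iff hα.ne_one hr]
  have e1 : expUnit (2 * Real.pi * Complex.I / l) t = expUnit (2 * Real.pi * Complex.I / l) t'
      ↔ ∃ n : ℤ, t' = t + l * n := by
    rw [← Units.val_inj]
    change Complex.exp _ = Complex.exp _ ↔ _
    rw [eq_comm, Complex.exp_eq_exp_iff_exists_int]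
    refine exists_congr fun n => ?_
    have e3 : 2 * Real.pi * Complex.I / l * t' - (2 * Real.pi * Complex.I / l * t
        + n * (2 * Real.pi * Complex.I)) = 2 * Real.pi * Complex.I / l * (t' - (t + l * n)) := by
      field_simp
    rw [← sub_eq_zero, e3, mul_eq_zero, or_iff_right hc, sub_eq_zero]
  rw [e1]
  constructor
  · rintro ⟨ε, τ, hm, rfl⟩
    rcases hm.sign (wedge_ne_zero h.1.1) with rfl | rfl
    · obtain ⟨n, rfl⟩ := (hT τ).mp hm
      exact ⟨n, by push_cast; ring⟩
    · exact absurd ⟨τ, hm⟩ hC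
  · rintro ⟨n, rfl⟩
    exact ⟨1, l * n, (hT _).mpr ⟨n, rfl⟩, by push_cast; ring⟩

theorem biholomorphic_complex_of_moves {α : ℝ} (hα : SPlusAdmissible α) {r : ℕ} (hr : r ≠ 0)
    {a b c : Fin 2 → ℝ} (h : CompatiblePair α a b ∧ CompatibleVec α r a b c)
    {τ₀ : ℝ} (hC : Moves α r a b c (-1) τ₀) : Biholomorphic (Set.range (slice h)) ℂ := by
  obtain ⟨p, hp⟩ := h.2
  obtain ⟨l, hl, hT⟩ := exists_translations_eq hα hr h.1 hp
  have hl' : (l : ℂ) ≠ 0 := by exact_mod_cast hl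
  have hpi : (2 * Real.pi : ℂ) ≠ 0 :=
    mul_ne_zero two_ne_zero (Complex.ofReal_ne_zero.mpr Real.pi_ne_zero)
  have hc : (2 * Real.pi / l : ℂ) ≠ 0 := div_ne_zero hpi hl'
  refine biholomorphic_range_slice hα hr h (cosMap (2 * Real.pi / l) (τ₀ / 2))
    (differentiable_cosMap _ _).continuous (isOpenMap_cosMap hc _) (surjective_cosMap hc _)
    (fun t t' => ?_) (fun W hW f => mdifferentiableOn_cosMap_iff hc _ hW f)
  rw [slice_eq_iff hα.ne_one hr]
  have e1 : cosMap (2 * Real.pi / l) (τ₀ / 2) t = cosMap (2 * Real.pi / l) (τ₀ / 2) t'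
      ↔ ∃ n : ℤ, t' = t + l * n ∨ t' = -t + (τ₀ + l * n) := by
    unfold cosMap
    rw [Complex.cos_eq_cos_iff]
    refine exists_congr fun n => or_congr ?_ ?_
    · have e3 : 2 * Real.pi / l * (t' - τ₀ / 2) - (2 * n * Real.pi
          + 2 * Real.pi / l * (t - τ₀ / 2)) = 2 * Real.pi / l * (t' - (t + l * n)) := by
        field_simp; ring
      rw [← sub_eq_zero, e3, mul_eq_zero, or_iff_right hc, sub_eq_zero]
    · have e3 : 2 * Real.pi / l * (t' - τ₀ / 2) - (2 * n * Real.pi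
          - 2 * Real.pi / l * (t - τ₀ / 2)) = 2 * Real.pi / l * (t' - (-t + (τ₀ + l * n))) := by
        field_simp; ring
      rw [← sub_eq_zero, e3, mul_eq_zero, or_iff_right hc, sub_eq_zero]
  rw [e1]
  constructor
  · rintro ⟨ε, τ, hm, rfl⟩
    rcases hm.sign (wedge_ne_zero h.1.1) with rfl | rfl
    · obtain ⟨n, rfl⟩ := (hT τ).mp hm
      exact ⟨n, Or.inl (by push_cast; ring)⟩
    · -- the composition of two inversions is a translation
      have h2 := hC.mul hα.ne_one hr hm
      rw [show (-1 : ℝ) * -1 = 1 by norm_num] at h2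
      obtain ⟨n, hn⟩ := (hT _).mp h2
      refine ⟨n, Or.inr ?_⟩
      have : τ = τ₀ + l * n := by linear_combination hn
      rw [this]; push_cast; ring
  · rintro ⟨n, rfl | rfl⟩
    · exact ⟨1, l * n, (hT _).mpr ⟨n, rfl⟩, by push_cast; ring⟩
    · have h2 := hC.mul hα.ne_one hr ((hT _).mpr ⟨n, rfl⟩)
      exact ⟨_, _, h2, by push_cast; ring⟩

/-- A component is biholomorphic to `ℂ` exactly when the stabiliser reverses `t`. -/
theorem biholomorphic_complex_iff {α : ℝ} (hα : SPlusAdmissible α) {r : ℕ} (hr : r ≠ 0)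
    {a b c : Fin 2 → ℝ} (h : CompatiblePair α a b ∧ CompatibleVec α r a b c) :
    Biholomorphic (Set.range (slice h)) ℂ ↔ ∃ τ, Moves α r a b c (-1) τ := by
  constructor
  · rintro ⟨e, -⟩
    by_contra hC
    obtain ⟨e', -⟩ := biholomorphic_units_of_not_moves hα hr h hC
    exact not_homeomorph_units.false (e.symm.trans e')
  · rintro ⟨τ₀, hC⟩
    exact biholomorphic_complex_of_moves hα hr h hC

/-! ### Matrices and pairs -/

theorem etaMap_surjective {α : ℝ} (hα : SPlusAdmissible α) : Function.Surjective (etaMap hα) := by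
  rintro ⟨M, hdet, hM⟩
  obtain ⟨a, ha⟩ := hM.exists_hasEigenvector
  have h0 := hα.ne_zero
  have ha1 : (toReal M).mulVec a = α • a := by
    have := ha.apply_eq_smul
    rwa [Matrix.toLin'_apply] at this
  have ha0 : a ≠ 0 := ha.2
  have hdet' : (toReal M).det = 1 := by rw [toReal_det, hdet]; simp
  have hchar : ∀ x : ℝ, (toReal M - x • 1).det = 1 - x * (toReal M).trace + x * x := by
    intro x
    rw [← hdet', Matrix.det_fin_two, Matrix.det_fin_two, Matrix.trace_fin_two]
    simp
    ring
  have hα0 : (toReal M - α • 1).det = 0 := by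
    rw [← Matrix.exists_mulVec_eq_zero_iff]
    exact ⟨a, ha0, by rw [Matrix.sub_mulVec, Matrix.smul_mulVec, Matrix.one_mulVec, ha1, sub_self]⟩
  -- the characteristic polynomial is reciprocal, so `α⁻¹` is the other eigenvalue
  have hα1 : (toReal M - α⁻¹ • 1).det = 0 := by
    rw [hchar] at hα0 ⊢
    field_simp
    linear_combination hα0
  obtain ⟨b, hb0, hb⟩ := Matrix.exists_mulVec_eq_zero_iff.mpr hα1
  have hb1 : (toReal M).mulVec b = α⁻¹ • b := by
    rw [Matrix.sub_mulVec, Matrix.smul_mulVec, Matrix.one_mulVec, sub_eq_zero] at hb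
    exact hb
  have hw : wedge b a ≠ 0 := by
    intro hw
    have hpar : ∀ i, a i • b = b i • a := by
      intro i
      unfold wedge at hw
      ext j
      fin_cases i <;> fin_cases j <;> simp <;> linarith
    have : ∀ i, a i • b = 0 := by
      intro i
      have e := congrArg (toReal M).mulVec (hpar i)
      rw [Matrix.mulVec_smul, Matrix.mulVec_smul, ha1, hb1, smul_comm, smul_comm _ α, ← hpar i] at e
      rw [← sub_eq_zero, ← sub_smul] at e
      have hne : α⁻¹ - α ≠ 0 := by
        have := sub_inv_ne_zero_of_one_lt hα.one_lt
        rw [← neg_sub]; exact neg_ne_zero.mpr this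
      exact (smul_eq_zero.mp e).resolve_left hne
    exact ha0 (funext fun i => (smul_eq_zero.mp (this i)).resolve_right hb0)
  have hN := eq_matN hw ha1 hb1
  refine ⟨⟨(a, b), linearIndependent_of_wedge_ne_zero hw, M, hN⟩, Subtype.ext (toReal_injective ?_)⟩
  rw [etaMap_spec]
  exact hN

/-- If `K` conjugates `N(α,a,b)` to `N(α,a',b')`, it maps the eigenlines of one matrix to those of
the other. -/
theorem pairRel_of_similar {α : ℝ} (hα : SPlusAdmissible α) {x y : Pairs α}
    (h : Similar α (etaMap hα x) (etaMap hα y)) : PairRel α x y := by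
  obtain ⟨K, hK⟩ := h
  have hwx := wedge_ne_zero x.2.1
  have hwy := wedge_ne_zero y.2.1
  have hKN : matN α y.1.1 y.1.2 * toReal K.val = toReal K.val * matN α x.1.1 x.1.2 := by
    rw [← etaMap_spec hα x, ← etaMap_spec hα y, ← toReal_mul, ← toReal_mul, hK, Matrix.mul_assoc,
      ← Units.val_mul, inv_mul_cancel, Units.val_one, Matrix.mul_one]
  have ea := eq_smul_fst hα.one_lt hwy (v := (toReal K.val).mulVec x.1.1) (by
    rw [Matrix.mulVec_mulVec, hKN, ← Matrix.mulVec_mulVec, matN_mulVec_fst α hwx,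
      Matrix.mulVec_smul])
  have eb := eq_smul_snd hα.one_lt hwy (v := (toReal K.val).mulVec x.1.2) (by
    rw [Matrix.mulVec_mulVec, hKN, ← Matrix.mulVec_mulVec, matN_mulVec_snd α hwx,
      Matrix.mulVec_smul])
  set s := wedge y.1.2 ((toReal K.val).mulVec x.1.1) / wedge y.1.2 y.1.1
  set u := wedge ((toReal K.val).mulVec x.1.2) y.1.1 / wedge y.1.2 y.1.1
  have hsu : s * u ≠ 0 := by
    have e := wedge_mulVec K.val x.1.1 x.1.2
    rw [ea, eb, wedge_smul] at e
    intro h0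
    rw [h0, zero_mul] at e
    have hd : (K.val.det : ℝ) * K.val.det = 1 := by exact_mod_cast GL_det_sq K
    have : (K.val.det : ℝ) = 0 := (mul_eq_zero.mp e.symm).resolve_right hwx
    rw [this] at hd
    norm_num at hd
  obtain ⟨hs, hu⟩ := mul_ne_zero_iff.mp hsu
  rcases lt_or_gt_of_ne hs with hneg | hpos
  · -- `-K` replaces `K`, because `μ` has to be positive
    have e : toReal (-K).val = -toReal K.val := by ext; simp [toReal]
    refine ⟨⟨-s⁻¹, -u⁻¹, -K, 0, neg_pos.mpr (inv_lt_zero.mpr hneg),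
      neg_ne_zero.mpr (inv_ne_zero hu)⟩, ?_, ?_⟩
    · change y.1.1 = -s⁻¹ • (toReal (-K).val).mulVec x.1.1
      rw [e, Matrix.neg_mulVec, ea, smul_neg, neg_smul, neg_neg, smul_smul, inv_mul_cancel₀ hs,
        one_smul]
    · change y.1.2 = -u⁻¹ • (toReal (-K).val).mulVec x.1.2
      rw [e, Matrix.neg_mulVec, eb, smul_neg, neg_smul, neg_neg, smul_smul, inv_mul_cancel₀ hu,
        one_smul]
  · refine ⟨⟨s⁻¹, u⁻¹, K, 0, inv_pos.mpr hpos, inv_ne_zero hu⟩, ?_, ?_⟩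
    · change y.1.1 = s⁻¹ • (toReal K.val).mulVec x.1.1
      rw [ea, smul_smul, inv_mul_cancel₀ hs, one_smul]
    · change y.1.2 = u⁻¹ • (toReal K.val).mulVec x.1.2
      rw [eb, smul_smul, inv_mul_cancel₀ hu, one_smul]

theorem similar_equivalence (α : ℝ) : Equivalence (Similar α) where
  refl N := ⟨1, by simp⟩
  symm := by
    rintro N N' ⟨K, h⟩
    refine ⟨K⁻¹, ?_⟩
    rw [h, inv_inv, ← Matrix.mul_assoc, ← Matrix.mul_assoc, Matrix.mul_assoc, ← Units.val_mul]
    simp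
  trans := by
    rintro N N' N'' ⟨K, h⟩ ⟨K', h'⟩
    refine ⟨K' * K, ?_⟩
    rw [h', h, mul_inv_rev, Units.val_mul, Units.val_mul]
    simp only [Matrix.mul_assoc]

theorem Psi_preimage_eq_fibre {α : ℝ} (hα : SPlusAdmissible α) (r : ℕ) (P : Pairs α) :
    Psi hα r ⁻¹' {Quot.mk _ (etaMap hα P)} = fibre r P := by
  ext q
  induction q using Quot.ind with
  | mk x =>
    change (Quot.mk (Similar α) (etaMap hα (pairOf x)) : SimClasses α) = Quot.mk _ (etaMap hα P) ↔
      (Quot.mk (PairRel α) (pairOf x) : PairClasses α) = Quot.mk _ P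
    rw [(similar_equivalence α).quot_mk_eq_iff, (pairRel_equivalence α).quot_mk_eq_iff]
    exact ⟨pairRel_of_similar hα, etaMap_similar hα⟩

end InoueII

theorem mainTheorem9 (α : ℝ) (hα : InoueII.SPlusAdmissible α) (r : ℕ) (hr : 0 < r) :
    Function.Surjective (InoueII.etaMap hα) ∧
    ∀ P : InoueII.Pairs α,
      InoueII.Psi hα r ⁻¹' {Quot.mk _ (InoueII.etaMap hα P)}
          = InoueII.fibre r P ∧
      (∀ q ∈ InoueII.fibre r P,
        (InoueII.Biholomorphic
            (connectedComponentIn (InoueII.fibre r P) q) ℂˣ ∨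
          InoueII.Biholomorphic
            (connectedComponentIn (InoueII.fibre r P) q) ℂ) ∧
        ∃ c, InoueII.CompatibleVec α r P.1.1 P.1.2 c ∧
          connectedComponentIn (InoueII.fibre r P) q
            = InoueII.orbitPart α r P.1.1 P.1.2 c) ∧
      ∀ (c : Fin 2 → ℝ) (p : Fin 2 → ℤ), InoueII.HasPi α r P.1.1 P.1.2 c p →
        (∃ q ∈ InoueII.fibre r P,
          InoueII.orbitPart α r P.1.1 P.1.2 c
            = connectedComponentIn (InoueII.fibre r P) q) ∧
        (InoueII.Biholomorphic (InoueII.orbitPart α r P.1.1 P.1.2 c) ℂ ↔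
          InoueII.ConditionC (InoueII.etaMap hα P).1 r P.1.1 p) ∧
        ∃ H : Subgroup (Equiv.Perm (InoueII.Cyl r P.1.1 P.1.2)),
          (H : Set (Equiv.Perm (InoueII.Cyl r P.1.1 P.1.2)))
              = InoueII.stabImage α r P.1.1 P.1.2 c ∧
          Finite H ∧ H ≤ InoueII.torsionGroup r P.1.1 P.1.2 ∧
          ((∃ h ∈ H, InoueII.SwapsEnds h) ↔
            InoueII.ConditionC (InoueII.etaMap hα P).1 r P.1.1 p) := by
  have hr0 : r ≠ 0 := hr.ne'
  have h0 := hα.ne_zero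
  have h1 := hα.ne_one
  refine ⟨InoueII.etaMap_surjective hα, fun P => ⟨InoueII.Psi_preimage_eq_fibre hα r P, ?_, ?_⟩⟩
  · intro q hq
    obtain ⟨c, h, t, rfl⟩ := InoueII.exists_slice_of_mem_fibre h0 h1 hr0 hq
    rw [InoueII.connectedComponentIn_fibre hα hr0 h t]
    refine ⟨?_, c, h.2, (InoueII.orbitPart_eq_range h1 hr0 h).symm⟩
    by_cases hC : ∃ τ, InoueII.Moves α r P.1.1 P.1.2 c (-1) τ
    · exact Or.inr ((InoueII.biholomorphic_complex_iff hα hr0 h).mpr hC)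
    · exact Or.inl (InoueII.biholomorphic_units_of_not_moves hα hr0 h hC)
  · intro c p hp
    have h : InoueII.CompatiblePair α P.1.1 P.1.2 ∧ InoueII.CompatibleVec α r P.1.1 P.1.2 c :=
      ⟨P.2, p, hp⟩
    have hw := InoueII.wedge_ne_zero P.2.1
    have hC := InoueII.conditionC_iff_moves hα hr0 P.2 hp (InoueII.etaMap_spec hα P).symm
    refine ⟨⟨InoueII.slice h 0, InoueII.slice_mem_fibre P h 0, ?_⟩, ?_,
      InoueII.stabGroup h1 hr0 c hw, rfl, (InoueII.stabImage_finite hα hr0 P.2 hp).to_subtype,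
      InoueII.stabGroup_le_torsionGroup hα hr0 P.2 hp, ?_⟩
    · rw [InoueII.orbitPart_eq_range h1 hr0 h, InoueII.connectedComponentIn_fibre hα hr0 h 0]
    · rw [InoueII.orbitPart_eq_range h1 hr0 h, hC]
      exact InoueII.biholomorphic_complex_iff hα hr0 h
    · rw [hC]
      exact InoueII.exists_swapsEnds_iff hw
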